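/- An arrow presentation $G$ is a finite set of circles $V(G)$ with finitely many disjoint labelled arrows lying on them, each label (an edge; $E(G)$ is the set of edges) being carried by exactly two arrows. Its boundary components are the closed curves obtained by removing, for each edge with arrows $\overrightarrow{p_1p_2}$, $\overrightarrow{q_1q_2}$, the two arrow arcs, and joining $q_2$ to $p_1$ and $p_2$ to $q_1$. A packaged arrow presentation $(G,\mathcal V,\mathcal B)$ is an arrow presentation with a partition $\mathcal V$ of its set of circles and a partition $\mathcal B$ of its set of boundary components; a vertex partitioned arrow presentation is a pair $(G,\mathcal V)$. Operations on an edge $e$ with arrows $\overrightarrow{p_1p_2}$, $\overrightarrow{q_1q_2}$: deletion $\backslash e$ forgets the two arrows; contraction $/e$ removes the two arrow arcs and identifies $p_1$ with $q_2$ and $p_2$ with $q_1$; Penrose-contraction $\times e$ removes the two arrow arcs and identifies $p_1$ with $q_1$ and $p_2$ with $q_2$. Contraction and Penrose-contraction merge the vertex classes of the circles meeting $e$ (new circles join the merged class), deletion does not; deletion and Penrose-contraction merge the boundary classes meeting $e$ (new boundary components join the merged class), contraction does not. Merge-deletion $\backslash\!\backslash e$ is deletion that also merges the vertex classes at $e$,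 and merge-contraction $/\!/e$ is contraction that also merges the boundary classes at $e$. The same operations act on vertex partitioned arrow presentations by forgetting $\mathcal B$. Let $Q(P)\in\mathbb Z[a,b,c,x,y,\alpha,\beta,\gamma]$ and $Z(P)\in\mathbb Z[a,b,\alpha,\beta,\gamma]$ be the unique functions of packaged arrow presentations $P=(G,\mathcal V,\mathcal B)$ such that for every edge $e$ $$Q(P)=aQ(P\backslash e)+bQ(P/e)+cQ(P\times e)+xQ(P\backslash\!\backslash e)+yQ(P/\!/e),\qquad Z(P)=aZ(P\backslash e)+bZ(P/e),$$ and $Q(P)=Z(P)=\alpha^{|V(G)|}\beta^{|\mathcal V|}\gamma^{|\mathcal B|}$ if $P$ has no edges. For a vertex partitioned arrow presentation $G$ put $\hat Q(G;a,b,c,x,\alpha,\beta)=Q(P;a,b,c,x,0,\alpha,\beta,1)$ and $\hat Z(G;a,b,\alpha,\beta)=Z(P;a,b,\alpha,\beta,1)$, where $P$ is obtained from $G$ by choosing any partition of the boundary components (the choice does not matter). A coupling of an edge $f$ of $G$ with an edge $e$ of $H$ is a bijection from the two arrows of $f$ to the two arrows of $e$. If it sends $\overrightarrow{p_1p_2}\mapsto\overrightarrow{q_1q_2}$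 and $\overrightarrow{p_3p_4}\mapsto\overrightarrow{q_3q_4}$, the 2-sum of $G$ and $H$ is obtained from their disjoint union by removing the four arrow arcs and identifying $p_i$ with $q_i$ ($i=1,\dots,4$); its vertex partition is generated by those of $G$ and $H$ together with merging the class of the circle of each arrow of $f$ with the class of the circle of its image. For couplings $\boldsymbol\varphi=\{\varphi_f\}_{f\in E(G)}$ of the edges of $G$ with a fixed edge $e$ of $H$, the tensor product $G\otimes_{\boldsymbol\varphi}H$ is obtained from $G$ by taking, successively for each edge $f$ of $G$ (in any order), the 2-sum with a new copy of $H$ along $f$ and $e$ with respect to $\varphi_f$. **Theorem.** Let $G$ and $H$ be vertex partitioned arrow presentations, let $e$ be an edge of $H$, and for each edge $f$ of $G$ let $\varphi_f$ be a coupling of $f$ and $e$. Let $a,b,\alpha,\beta$ be indeterminates. Then the system $$\alpha\beta\begin{bmatrix}\alpha\beta&1&1&\alpha\\1&\alpha&1&1\\1&1&\alpha&1\\\alpha&1&1&\alpha\end{bmatrix}\begin{bmatrix}\phi_{(=,2)}\\\phi_{\parallel}\\\phi_{\times}\\\phi_{(=,1)}\end{bmatrix}=\begin{bmatrix}\hat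 Z(H\backslash e;a,b,\alpha,\beta)\\\hat Z(H/e;a,b,\alpha,\beta)\\\hat Z(H\times e;a,b,\alpha,\beta)\\\hat Z(H\backslash\!\backslash e;a,b,\alpha,\beta)\end{bmatrix}$$ has a unique solution over the field of fractions of $\mathbb Z[a,b,\alpha,\beta]$, and for this solution $$\hat Z(G\otimes_{\boldsymbol\varphi}H;a,b,\alpha,\beta)=\hat Q(G;\phi_{(=,2)},\phi_{\parallel},\phi_{\times},\phi_{(=,1)},\alpha,\beta).$$ -/

import Mathlib

noncomputable section

/-! ## Relinking a fixed-point-free involution on a distinguished set of points -/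

/-- The map that agrees with `τ` off the range of `pts` and sends `pts x` to `pts (link x)`. -/
def relink {ι P : Type} (τ : P → P) (pts : ι → P) (link : ι → ι) : P → P :=
  Function.extend pts (fun x => pts (link x)) τ

theorem relink_pts {ι P : Type} {τ : P → P} {pts : ι → P} {link : ι → ι}
    (hp : Function.Injective pts) (x : ι) : relink τ pts link (pts x) = pts (link x) :=
  hp.extend_apply _ _ _

theorem relink_off {ι P : Type} {τ : P → P} {pts : ι → P} {link : ι → ι} {p : P}
    (h : ¬ ∃ x, pts x = p) : relink τ pts link p = τ p :=
  Function.extend_apply' _ _ _ h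

theorem relink_involutive {ι P : Type} {τ : P → P} {pts : ι → P} {link : ι → ι}
    (hp : Function.Injective pts) (hl : Function.Involutive link) (hτ : Function.Involutive τ)
    (hr : ∀ x, ∃ y, τ (pts x) = pts y) : Function.Involutive (relink τ pts link) := by
  intro p
  by_cases h : ∃ x, pts x = p
  · obtain ⟨x, rfl⟩ := h
    rw [relink_pts hp, relink_pts hp, hl]
  · rw [relink_off h, relink_off, hτ]
    rintro ⟨x, hx⟩
    obtain ⟨y, hy⟩ := hr x
    exact h ⟨y, by rw [← hy, hx, hτ]⟩

theorem relink_ne {ι P : Type} {τ : P → P} {pts : ι → P} {link : ι → ι}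
    (hp : Function.Injective pts) (hl : ∀ x, link x ≠ x) (hτ : ∀ p, τ p ≠ p) (p : P) :
    relink τ pts link p ≠ p := by
  by_cases h : ∃ x, pts x = p
  · obtain ⟨x, rfl⟩ := h
    rw [relink_pts hp]
    exact fun h => hl x (hp h)
  · rw [relink_off h]
    exact hτ p

theorem sumMap_involutive {P Q : Type} {f : P → P} {g : Q → Q} (hf : Function.Involutive f)
    (hg : Function.Involutive g) : Function.Involutive (Sum.map f g) := by
  rintro (p | p)
  · exact congrArg Sum.inl (hf p)
  · exact congrArg Sum.inr (hg p)

theorem sumMap_ne {P Q : Type} {f : P → P} {g : Q → Q} (hf : ∀ p, f p ≠ p)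
    (hg : ∀ p, g p ≠ p) (p : P ⊕ Q) : Sum.map f g p ≠ p := by
  rcases p with p | p
  · exact fun h => hf p (Sum.inl_injective h)
  · exact fun h => hg p (Sum.inr_injective h)

/-! ## Arrow presentations -/

/-- A (finite) arrow presentation, described combinatorially. The circles are cut at a finite set
`Pt` of points, an even positive number of them on each circle, into segments that are alternately
of two kinds; `σ` (resp. `τ`) sends a point to the other end of the segment of the first (resp.
second) kind at that point. Some of the segments of the second kind carry an arrow: each edge
`e : E` has two arrows `i : Bool`, and the `i`-th arrow of `e` runs from the point
`arrow (e, i, false)` to the point `arrow (e, i, true)`. All other segments are plain arcs of the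
circles (in particular a circle without arrows may be given by two points). -/
structure ArrowPresentation where
  Pt : Type
  E : Type
  [finitePt : Finite Pt]
  [finiteE : Finite E]
  σ : Pt → Pt
  σ_involutive : Function.Involutive σ
  σ_ne : ∀ p, σ p ≠ p
  τ : Pt → Pt
  τ_involutive : Function.Involutive τ
  τ_ne : ∀ p, τ p ≠ p
  arrow : E × Bool × Bool → Pt
  arrow_injective : Function.Injective arrow
  τ_arrow : ∀ e i s, τ (arrow (e, i, s)) = arrow (e, i, !s)

attribute [instance] ArrowPresentation.finitePt ArrowPresentation.finiteE

/-- The relation "in the same component" for the closed curves formed by the segments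
`p — f p` and `p — g p`. -/
def curveSetoid {P : Type} (f g : P → P) : Setoid P :=
  Relation.EqvGen.setoid (fun p q => q = f p ∨ q = g p)

/-- The equivalence relation `r` with the classes of `p` and `q` merged. -/
def mergeClasses {P : Type} (r : Setoid P) (p q : P) : Setoid P :=
  r ⊔ Relation.EqvGen.setoid (fun p' q' => p' = p ∧ q' = q)

/-- The three ways of treating the pair of arrows of an edge: keep the arcs of the circles
(deletion), or reconnect the four ends as in contraction, or as in Penrose-contraction. -/
inductive Smoothing
  | del
  | con
  | pen

/-- Which end (of which arrow) a given end is connected to. With arrows `p₁p₂` and `q₁q₂`: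
deletion keeps `p₁p₂`, `q₁q₂`, contraction identifies `p₁` with `q₂` and `p₂` with `q₁`,
Penrose-contraction identifies `p₁` with `q₁` and `p₂` with `q₂`. -/
def Smoothing.link : Smoothing → Bool × Bool → Bool × Bool
  | .del, (i, s) => (i, !s)
  | .con, (i, s) => (!i, !s)
  | .pen, (i, s) => (!i, s)

theorem Smoothing.link_involutive (k : Smoothing) : Function.Involutive k.link := by
  rintro ⟨i, s⟩
  cases k <;> simp [Smoothing.link]

theorem Smoothing.link_ne (k : Smoothing) (x : Bool × Bool) : k.link x ≠ x := by
  obtain ⟨i, s⟩ := x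
  cases k <;> simp [Smoothing.link]

namespace ArrowPresentation

variable (G : ArrowPresentation)

/-- The vertices of an arrow presentation: its circles. -/
def V : Type := Quotient (curveSetoid G.σ G.τ)

/-- The segments that replace those of `τ` in the boundary components: the arrow segments
`p₁p₂`, `q₁q₂` of each edge are removed, and `q₂` is joined to `p₁`, and `p₂` to `q₁`. -/
def δ : G.Pt → G.Pt :=
  relink G.τ G.arrow (fun x => (x.1, !x.2.1, !x.2.2))

/-- The four ends of the arrows of the edge `e`. -/
abbrev ends (e : G.E) (x : Bool × Bool) : G.Pt := G.arrow (e, x)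

theorem ends_injective (e : G.E) : Function.Injective (G.ends e) := fun x y h => by
  simpa using G.arrow_injective h

theorem ends_ne {e e' : G.E} (h : e' ≠ e) (x y : Bool × Bool) : G.ends e x ≠ G.ends e' y :=
  fun h' => h (congrArg Prod.fst (G.arrow_injective h')).symm

/-- Delete, contract or Penrose-contract an edge of an arrow presentation. -/
abbrev smooth (k : Smoothing) (e : G.E) : ArrowPresentation where
  Pt := G.Pt
  E := {e' : G.E // e' ≠ e}
  σ := G.σ
  σ_involutive := G.σ_involutive
  σ_ne := G.σ_ne
  τ := relink G.τ (G.ends e) k.link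
  τ_involutive := relink_involutive (G.ends_injective e) k.link_involutive G.τ_involutive
    fun x => ⟨(x.1, !x.2), G.τ_arrow e x.1 x.2⟩
  τ_ne := relink_ne (G.ends_injective e) k.link_ne G.τ_ne
  arrow := fun x => G.arrow (x.1.1, x.2)
  arrow_injective := by
    rintro ⟨⟨e₁, h₁⟩, x₁⟩ ⟨⟨e₂, h₂⟩, x₂⟩ h
    simpa using G.arrow_injective h
  τ_arrow := fun e' i s => by
    rw [relink_off, G.τ_arrow]
    rintro ⟨x, hx⟩
    exact G.ends_ne e'.2 x (i, s) hx

/-- The points that are joined in a 2-sum: the ends of the arrows of `f` and those of `e`. -/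
def sumEnds (H : ArrowPresentation) (f : G.E) (e : H.E) :
    (Bool × Bool) ⊕ (Bool × Bool) → G.Pt ⊕ H.Pt :=
  Sum.map (G.ends f) (H.ends e)

/-- The joins in a 2-sum: if `φ` sends the arrow `p₁p₂` to `q₁q₂`, then `p₁` is joined to `q₁` and
`p₂` to `q₂`. -/
def sumLink (φ : Bool ≃ Bool) : (Bool × Bool) ⊕ (Bool × Bool) → (Bool × Bool) ⊕ (Bool × Bool)
  | .inl (i, s) => .inr (φ i, s)
  | .inr (j, s) => .inl (φ.symm j, s)

theorem sumEnds_injective (H : ArrowPresentation) (f : G.E) (e : H.E) :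
    Function.Injective (G.sumEnds H f e) :=
  (G.ends_injective f).sumMap (H.ends_injective e)

/-- The 2-sum of `G` and `H` along the edges `f` and `e`, with respect to the coupling `φ` (a
bijection from the pair of arrows of `f` to the pair of arrows of `e`): the four arrows and the
arcs they lie on are removed, and corresponding ends are joined. -/
abbrev twoSum (f : G.E) (H : ArrowPresentation) (e : H.E) (φ : Bool ≃ Bool) :
    ArrowPresentation where
  Pt := G.Pt ⊕ H.Pt
  E := {f' : G.E // f' ≠ f} ⊕ {e' : H.E // e' ≠ e}
  σ := Sum.map G.σ H.σ
  σ_involutive := by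
    exact sumMap_involutive G.σ_involutive H.σ_involutive
  σ_ne := by
    exact sumMap_ne G.σ_ne H.σ_ne
  τ := relink (Sum.map G.τ H.τ) (G.sumEnds H f e) (sumLink φ)
  τ_involutive := by
    refine relink_involutive (G.sumEnds_injective H f e) ?_ ?_ ?_
    · rintro (⟨i, s⟩ | ⟨j, s⟩) <;> simp [sumLink]
    · exact sumMap_involutive G.τ_involutive H.τ_involutive
    · rintro (⟨i, s⟩ | ⟨j, s⟩)
      · exact ⟨.inl (i, !s), congrArg Sum.inl (G.τ_arrow f i s)⟩
      · exact ⟨.inr (j, !s), congrArg Sum.inr (H.τ_arrow e j s)⟩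
  τ_ne := by
    refine relink_ne (G.sumEnds_injective H f e) ?_ ?_
    · rintro (⟨i, s⟩ | ⟨j, s⟩) <;> simp [sumLink]
    · exact sumMap_ne G.τ_ne H.τ_ne
  arrow := fun x => match x with
    | (.inl f', y) => .inl (G.arrow (f'.1, y))
    | (.inr e', y) => .inr (H.arrow (e'.1, y))
  arrow_injective := by
    rintro ⟨⟨f₁, h₁⟩ | ⟨e₁, h₁⟩, x₁⟩ ⟨⟨f₂, h₂⟩ | ⟨e₂, h₂⟩, x₂⟩ h
    · simpa using G.arrow_injective (Sum.inl_injective h)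
    · cases h
    · cases h
    · simpa using H.arrow_injective (Sum.inr_injective h)
  τ_arrow := by
    rintro (f' | e') i s
    · rw [relink_off]
      · exact congrArg Sum.inl (G.τ_arrow f' i s)
      · rintro ⟨x | x, hx⟩
        · exact G.ends_ne f'.2 x (i, s) (Sum.inl_injective hx)
        · cases hx
    · rw [relink_off]
      · exact congrArg Sum.inr (H.τ_arrow e' i s)
      · rintro ⟨x | x, hx⟩
        · cases hx
        · exact H.ends_ne e'.2 x (i, s) (Sum.inr_injective hx)

end ArrowPresentation

/-! ## Vertex partitioned and packaged arrow presentations -/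

/-- A vertex partitioned arrow presentation. The partition of the set of circles is given by the
equivalence relation `vtx` that it induces on the points: two points are related if they lie on
circles of the same block. -/
structure VertexPartitioned extends ArrowPresentation where
  vtx : Setoid Pt
  curve_le_vtx : curveSetoid σ τ ≤ vtx

/-- A packaged arrow presentation: in addition a partition of the set of boundary components, again
given by the equivalence relation that it induces on the points. -/
structure Packaged extends VertexPartitioned where
  bdy : Setoid Pt
  curve_le_bdy : curveSetoid σ toArrowPresentation.δ ≤ bdy

/-- The five operations on edges: deletion, contraction, Penrose-contraction, merge-deletion and
merge-contraction. -/
inductive EdgeOp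
  | del
  | con
  | pen
  | mdel
  | mcon
  deriving DecidableEq

instance : Fintype EdgeOp where
  elems := {.del, .con, .pen, .mdel, .mcon}
  complete := fun o => by cases o <;> simp

/-- The effect of an operation on the underlying arrow presentation. -/
def EdgeOp.smoothing : EdgeOp → Smoothing
  | .del => .del
  | .con => .con
  | .pen => .pen
  | .mdel => .del
  | .mcon => .con

/-- All operations but deletion merge the vertex classes at the edge. -/
def EdgeOp.mergeVtx : EdgeOp → Prop
  | .del => False
  | _ => True

/-- All operations but contraction merge the boundary classes at the edge. -/
def EdgeOp.mergeBdy : EdgeOp → Prop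
  | .con => False
  | _ => True

theorem curveSetoid_le_iff {P : Type} {f g : P → P} {r : Setoid P} :
    curveSetoid f g ≤ r ↔ ∀ p, r p (f p) ∧ r p (g p) := by
  constructor
  · intro h p
    exact ⟨h (Relation.EqvGen.rel _ _ (Or.inl rfl)), h (Relation.EqvGen.rel _ _ (Or.inr rfl))⟩
  · intro h
    refine Setoid.eqvGen_le ?_
    rintro p q (rfl | rfl)
    exacts [(h p).1, (h p).2]

theorem le_mergeClasses {P : Type} (r : Setoid P) (p q : P) : r ≤ mergeClasses r p q :=
  le_sup_left

theorem mergeClasses_rel {P : Type} (r : Setoid P) (p q : P) : mergeClasses r p q p q :=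
  (le_sup_right : _ ≤ mergeClasses r p q) (Relation.EqvGen.rel _ _ ⟨rfl, rfl⟩)

namespace VertexPartitioned

variable (G : VertexPartitioned)

open Classical in
/-- The vertex partition after an operation on `e`: the vertex classes of the two arrows of `e` are
merged, unless the operation is deletion. (Circles that are created lie in the merged class.) -/
def opVtx (o : EdgeOp) (e : G.E) : Setoid G.Pt :=
  if o.mergeVtx then mergeClasses G.vtx (G.arrow (e, false, false)) (G.arrow (e, true, false))
  else G.vtx

theorem vtx_le_opVtx (o : EdgeOp) (e : G.E) : G.vtx ≤ G.opVtx o e := by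
  unfold opVtx
  split_ifs
  · exact le_mergeClasses _ _ _
  · exact le_rfl

theorem vtx_σ (p : G.Pt) : G.vtx p (G.σ p) := (curveSetoid_le_iff.1 G.curve_le_vtx p).1

theorem vtx_τ (p : G.Pt) : G.vtx p (G.τ p) := (curveSetoid_le_iff.1 G.curve_le_vtx p).2

theorem opVtx_ends (o : EdgeOp) (e : G.E) (x : Bool × Bool) :
    G.opVtx o e (G.ends e x) (G.ends e (o.smoothing.link x)) := by
  have h1 : ∀ i s s', G.opVtx o e (G.arrow (e, i, s)) (G.arrow (e, i, s')) := by
    intro i s s'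
    refine G.vtx_le_opVtx o e ?_
    have h := G.vtx_τ (G.arrow (e, i, s))
    rw [G.τ_arrow] at h
    by_cases hs : s' = s
    · subst hs; exact Setoid.refl' _ _
    · rwa [show (!s) = s' by cases s <;> cases s' <;> simp_all] at h
  obtain ⟨i, s⟩ := x
  by_cases ho : o.mergeVtx
  · have h2 : G.opVtx o e (G.arrow (e, false, false)) (G.arrow (e, true, false)) := by
      rw [opVtx, if_pos ho]
      exact mergeClasses_rel _ _ _
    have h3 : ∀ i s i' s', G.opVtx o e (G.arrow (e, i, s)) (G.arrow (e, i', s')) := by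
      intro i s i' s'
      refine Setoid.trans' _ (h1 i s false) (Setoid.trans' _ ?_ (h1 i' false s'))
      cases i <;> cases i'
      · exact Setoid.refl' _ _
      · exact h2
      · exact Setoid.symm' _ h2
      · exact Setoid.refl' _ _
    exact h3 _ _ _ _
  · cases o <;> simp only [EdgeOp.mergeVtx, not_true_eq_false] at ho
    exact h1 _ _ _

/-- The five operations on the edges of a vertex partitioned arrow presentation. (Here contraction
and merge-contraction agree.) -/
abbrev op (o : EdgeOp) (e : G.E) : VertexPartitioned where
  toArrowPresentation := G.smooth o.smoothing e
  vtx := G.opVtx o e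
  curve_le_vtx := by
    refine curveSetoid_le_iff.2 fun p => ⟨G.vtx_le_opVtx o e (G.vtx_σ p), ?_⟩
    change G.opVtx o e p (relink G.τ (G.ends e) o.smoothing.link p)
    by_cases h : ∃ x, G.ends e x = p
    · obtain ⟨x, rfl⟩ := h
      rw [relink_pts (G.ends_injective e)]
      exact G.opVtx_ends o e x
    · rw [relink_off h]
      exact G.vtx_le_opVtx o e (G.vtx_τ p)

/-- The vertex partition of a 2-sum: the one generated by the given partitions and by merging the
class of each arrow `p₁p₂` of `f` with the class of its image `q₁q₂` among the arrows of `e`. -/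
def sumVtx (f : G.E) (H : VertexPartitioned) (e : H.E) (φ : Bool ≃ Bool) :
    Setoid (G.Pt ⊕ H.Pt) :=
  Relation.EqvGen.setoid fun p q =>
    (∃ p' q', G.vtx p' q' ∧ p = .inl p' ∧ q = .inl q') ∨
    (∃ p' q', H.vtx p' q' ∧ p = .inr p' ∧ q = .inr q') ∨
    (∃ i s, p = .inl (G.arrow (f, i, s)) ∧ q = .inr (H.arrow (e, φ i, s)))

/-- The 2-sum of vertex partitioned arrow presentations. -/
abbrev twoSum (f : G.E) (H : VertexPartitioned) (e : H.E) (φ : Bool ≃ Bool) :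
    VertexPartitioned where
  toArrowPresentation := G.toArrowPresentation.twoSum f H.toArrowPresentation e φ
  vtx := G.sumVtx f H e φ
  curve_le_vtx := by
    have hG : ∀ p q, G.vtx p q → G.sumVtx f H e φ (.inl p) (.inl q) := fun p q h =>
      Relation.EqvGen.rel _ _ (Or.inl ⟨p, q, h, rfl, rfl⟩)
    have hH : ∀ p q, H.vtx p q → G.sumVtx f H e φ (.inr p) (.inr q) := fun p q h =>
      Relation.EqvGen.rel _ _ (Or.inr (Or.inl ⟨p, q, h, rfl, rfl⟩))
    have hS : ∀ i s, G.sumVtx f H e φ (.inl (G.arrow (f, i, s))) (.inr (H.arrow (e, φ i, s))) :=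
      fun i s => Relation.EqvGen.rel _ _ (Or.inr (Or.inr ⟨i, s, rfl, rfl⟩))
    refine curveSetoid_le_iff.2 fun p => ?_
    constructor
    · rcases p with p | p
      · exact hG _ _ (G.vtx_σ p)
      · exact hH _ _ (H.vtx_σ p)
    · change G.sumVtx f H e φ p (relink (Sum.map G.τ H.τ) (G.sumEnds _ f e)
        (ArrowPresentation.sumLink φ) p)
      by_cases h : ∃ x, G.sumEnds H.toArrowPresentation f e x = p
      · obtain ⟨x, rfl⟩ := h
        rw [relink_pts (G.sumEnds_injective _ f e)]
        rcases x with ⟨i, s⟩ | ⟨j, s⟩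
        · exact hS i s
        · have := hS (φ.symm j) s
          rw [Equiv.apply_symm_apply] at this
          exact Setoid.symm' _ this
      · rw [relink_off h]
        rcases p with p | p
        · exact hG _ _ (G.vtx_τ p)
        · exact hH _ _ (H.vtx_τ p)

/-- Starting with `G`, take the 2-sum at each edge `f` in the list `l` with a new copy of `H`, along
the edge `e` of that copy and with respect to the coupling `φ f`. The embedding records the edges of
`G` that have not been used yet as edges of the result. -/
def sumList (H : VertexPartitioned) (e : H.E) (φ : G.E → (Bool ≃ Bool)) :
    (l : List G.E) → l.Nodup → Σ K : VertexPartitioned, {f : G.E // f ∉ l} ↪ K.E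
  | [], _ => ⟨G, ⟨fun f => f.1, Subtype.val_injective⟩⟩
  | f :: l, h =>
    let K := sumList H e φ l (List.nodup_cons.1 h).2
    let f₀ : K.1.E := K.2 ⟨f, (List.nodup_cons.1 h).1⟩
    ⟨K.1.twoSum f₀ H e (φ f),
      ⟨fun f' => Sum.inl ⟨K.2 ⟨f'.1, fun hf => f'.2 (List.mem_cons_of_mem f hf)⟩, fun hf =>
          f'.2 (List.mem_cons.2 (Or.inl (congrArg Subtype.val (K.2.injective hf))))⟩,
        fun f₁ f₂ hf => by
          have h' := congrArg Subtype.val (Sum.inl_injective hf)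
          exact Subtype.ext (congrArg (fun z => z.1) (K.2.injective h'))⟩⟩

/-- The tensor product of `G` and `H`: the 2-sum with a copy of `H` is taken at each edge of `G`,
where `l` lists the edges of `G` in the order in which this is done. -/
def tensor (H : VertexPartitioned) (e : H.E) (φ : G.E → (Bool ≃ Bool)) (l : List G.E)
    (hl : l.Nodup) (_ : ∀ f, f ∈ l) : VertexPartitioned :=
  (G.sumList H e φ l hl).1

/-- The packaged arrow presentation in which all boundary components are in one block. -/
abbrev pack : Packaged where
  toVertexPartitioned := G
  bdy := ⊤
  curve_le_bdy := le_top

end VertexPartitioned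

namespace Packaged

variable (G : Packaged)

open Classical in
/-- The boundary partition after an operation on `e`, with arrows `p₁p₂` and `q₁q₂`: the boundary
classes at `e`, namely that of `p₁` and `q₂` and that of `p₂` and `q₁`, are merged, unless the
operation is contraction. (Boundary components that are created lie in the merged class.) -/
def opBdy (o : EdgeOp) (e : G.E) : Setoid G.Pt :=
  if o.mergeBdy then mergeClasses G.bdy (G.arrow (e, false, false)) (G.arrow (e, false, true))
  else G.bdy

theorem bdy_le_opBdy (o : EdgeOp) (e : G.E) : G.bdy ≤ G.opBdy o e := by
  unfold opBdy
  split_ifs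
  · exact le_mergeClasses _ _ _
  · exact le_rfl

theorem bdy_σ (p : G.Pt) : G.bdy p (G.σ p) := (curveSetoid_le_iff.1 G.curve_le_bdy p).1

theorem bdy_δ (p : G.Pt) : G.bdy p (G.δ p) := (curveSetoid_le_iff.1 G.curve_le_bdy p).2

theorem opBdy_ends (o : EdgeOp) (e : G.E) (x : Bool × Bool) :
    G.opBdy o e (G.ends e x) (G.ends e (o.smoothing.link x)) := by
  have h1 : ∀ i s, G.opBdy o e (G.arrow (e, i, s)) (G.arrow (e, !i, !s)) := by
    intro i s
    refine G.bdy_le_opBdy o e ?_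
    have h := G.bdy_δ (G.arrow (e, i, s))
    rwa [ArrowPresentation.δ, relink_pts G.arrow_injective] at h
  obtain ⟨i, s⟩ := x
  by_cases ho : o.mergeBdy
  · have h2 : G.opBdy o e (G.arrow (e, false, false)) (G.arrow (e, false, true)) := by
      rw [opBdy, if_pos ho]
      exact mergeClasses_rel _ _ _
    have h3 : ∀ i s, G.opBdy o e (G.arrow (e, false, false)) (G.arrow (e, i, s)) := by
      intro i s
      cases i <;> cases s
      · exact Setoid.refl' _ _
      · exact h2
      · exact Setoid.trans' _ h2 (h1 false true)
      · exact h1 false false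
    exact Setoid.trans' _ (Setoid.symm' _ (h3 _ _)) (h3 _ _)
  · cases o <;> simp only [EdgeOp.mergeBdy, not_true_eq_false] at ho
    exact h1 _ _

theorem smooth_δ (G : ArrowPresentation) (k : Smoothing) (e : G.E) :
    (G.smooth k e).δ = relink G.δ (G.ends e) k.link := by
  funext p
  by_cases h : ∃ x, G.ends e x = p
  · obtain ⟨x, rfl⟩ := h
    rw [relink_pts (G.ends_injective e), ArrowPresentation.δ, relink_off]
    · exact relink_pts (G.ends_injective e) x
    · rintro ⟨⟨e', y⟩, hy⟩
      exact G.ends_ne e'.2 x y hy.symm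
  · rw [relink_off h]
    by_cases h' : ∃ y, (G.smooth k e).arrow y = p
    · obtain ⟨y, rfl⟩ := h'
      rw [ArrowPresentation.δ, relink_pts (G.smooth k e).arrow_injective]
      exact (relink_pts (link := fun x => (x.1, !x.2.1, !x.2.2)) G.arrow_injective
        (y.1.1, y.2)).symm
    · rw [ArrowPresentation.δ, ArrowPresentation.δ, relink_off h', relink_off]
      · exact relink_off h
      · rintro ⟨⟨e', y⟩, hy⟩
        by_cases he : e' = e
        · subst he
          exact h ⟨y, hy⟩
        · exact h' ⟨(⟨e', he⟩, y), hy⟩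

/-- The five operations on the edges of a packaged arrow presentation. -/
abbrev op (o : EdgeOp) (e : G.E) : Packaged where
  toVertexPartitioned := G.toVertexPartitioned.op o e
  bdy := G.opBdy o e
  curve_le_bdy := by
    refine curveSetoid_le_iff.2 fun p => ⟨G.bdy_le_opBdy o e (G.bdy_σ p), ?_⟩
    change G.opBdy o e p ((G.smooth o.smoothing e).δ p)
    rw [smooth_δ]
    by_cases h : ∃ x, G.ends e x = p
    · obtain ⟨x, rfl⟩ := h
      rw [relink_pts (G.ends_injective e)]
      exact G.opBdy_ends o e x
    · rw [relink_off h]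
      exact G.bdy_le_opBdy o e (G.bdy_δ p)

/-- The number of vertices. -/
def numV : ℕ := Nat.card G.V

/-- The number of blocks of the vertex partition. -/
def numVtxClasses : ℕ := Nat.card (Quotient G.vtx)

/-- The number of blocks of the boundary partition. -/
def numBdyClasses : ℕ := Nat.card (Quotient G.bdy)


/-! ### Existence and uniqueness of the deletion-contraction invariant

The state sum below is only used to show that the defining recursion has a solution. -/

section StateSum

open Classical in
/-- The pairs of vertex classes merged by an operation on an edge. -/
def vtxRel (o : EdgeOp) (e : G.E) : Setoid G.Pt :=
  if o.mergeVtx then Relation.EqvGen.setoid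
    (fun p q => p = G.arrow (e, false, false) ∧ q = G.arrow (e, true, false)) else ⊥

open Classical in
/-- The pairs of boundary classes merged by an operation on an edge. -/
def bdyRel (o : EdgeOp) (e : G.E) : Setoid G.Pt :=
  if o.mergeBdy then Relation.EqvGen.setoid
    (fun p q => p = G.arrow (e, false, false) ∧ q = G.arrow (e, false, true)) else ⊥

theorem opVtx_eq (o : EdgeOp) (e : G.E) : G.opVtx o e = G.vtx ⊔ G.vtxRel o e := by
  unfold VertexPartitioned.opVtx vtxRel mergeClasses
  split_ifs <;> simp

theorem opBdy_eq (o : EdgeOp) (e : G.E) : G.opBdy o e = G.bdy ⊔ G.bdyRel o e := by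
  unfold opBdy bdyRel mergeClasses
  split_ifs <;> simp

/-- The involution `τ` after applying the operation `t e` to each edge `e`. -/
def stateτ (t : G.E → EdgeOp) : G.Pt → G.Pt :=
  relink G.τ G.arrow (fun x => (x.1, (t x.1).smoothing.link x.2))

/-- The contribution of the state `t`. -/
def stateTerm {R : Type} [CommRing R] (w : EdgeOp → R) (α β γ : R) [Fintype G.E]
    (t : G.E → EdgeOp) : R :=
  (∏ e, w (t e)) * (α ^ Nat.card (Quotient (curveSetoid G.σ (G.stateτ t))) *
    β ^ Nat.card (Quotient (G.vtx ⊔ ⨆ e, G.vtxRel (t e) e)) *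
    γ ^ Nat.card (Quotient (G.bdy ⊔ ⨆ e, G.bdyRel (t e) e)))

theorem stateτ_op (e : G.E) (t : G.E → EdgeOp) :
    (G.op (t e) e).stateτ (fun e' => t e'.1) = G.stateτ t := by
  funext p
  by_cases h : ∃ x, G.arrow x = p
  · obtain ⟨⟨e', x⟩, rfl⟩ := h
    rw [stateτ, stateτ, relink_pts G.arrow_injective]
    by_cases he : e' = e
    · subst he
      rw [relink_off]
      · exact relink_pts (G.ends_injective e') x
      · rintro ⟨⟨e₁, y⟩, hy⟩
        exact G.ends_ne e₁.2 x y hy.symm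
    · exact relink_pts (link := fun x : {e' : G.E // e' ≠ e} × Bool × Bool =>
        (x.1, (t x.1.1).smoothing.link x.2)) (G.op (t e) e).arrow_injective (⟨e', he⟩, x)
  · rw [stateτ, stateτ, relink_off h, relink_off]
    · exact relink_off fun ⟨x, hx⟩ => h ⟨(e, x), hx⟩
    · rintro ⟨⟨e₁, y⟩, hy⟩
      exact h ⟨(e₁.1, y), hy⟩

theorem sup_iSup_op {L E : Type} [CompleteLattice L] (r : L) (f : E → L) (e : E) :
    r ⊔ f e ⊔ ⨆ e' : {e' : E // e' ≠ e}, f e'.1 = r ⊔ ⨆ e', f e' := by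
  rw [iSup_split_single f e, iSup_subtype, sup_assoc]

theorem stateTerm_op {R : Type} [CommRing R] (w : EdgeOp → R) (α β γ : R) (o : EdgeOp) (e : G.E)
    [Fintype G.E] [Fintype (G.op o e).E] (t : G.E → EdgeOp) (ho : t e = o) :
    G.stateTerm w α β γ t = w o * (G.op o e).stateTerm w α β γ (fun e' => t e'.1) := by
  classical
  subst ho
  have h1 : (G.op (t e) e).vtx ⊔ ⨆ e', (G.op (t e) e).vtxRel (t e'.1) e' =
      G.vtx ⊔ ⨆ e, G.vtxRel (t e) e := by
    rw [← sup_iSup_op G.vtx (fun e => G.vtxRel (t e) e) e, ← opVtx_eq]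
    rfl
  have h2 : (G.op (t e) e).bdy ⊔ ⨆ e', (G.op (t e) e).bdyRel (t e'.1) e' =
      G.bdy ⊔ ⨆ e, G.bdyRel (t e) e := by
    rw [← sup_iSup_op G.bdy (fun e => G.bdyRel (t e) e) e, ← opBdy_eq]
    rfl
  unfold stateTerm
  rw [h1, h2, stateτ_op, Fintype.prod_eq_mul_prod_subtype_ne (fun e => w (t e)) e, mul_assoc]
  congr!

/-- The sum over all states. -/
def stateSum {R : Type} [CommRing R] (w : EdgeOp → R) (α β γ : R) : R :=
  letI := Fintype.ofFinite G.E
  letI := Classical.decEq G.E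
  ∑ t : G.E → EdgeOp, G.stateTerm w α β γ t

theorem stateSum_op {R : Type} [CommRing R] (w : EdgeOp → R) (α β γ : R) (e : G.E) :
    G.stateSum w α β γ = ∑ o, w o * (G.op o e).stateSum w α β γ := by
  let _ := Fintype.ofFinite G.E
  let _ := Classical.decEq G.E
  unfold stateSum
  rw [← (Equiv.funSplitAt e EdgeOp).symm.sum_comp, Fintype.sum_prod_type]
  refine Finset.sum_congr rfl fun o _ => ?_
  let _ := Fintype.ofFinite (G.op o e).E
  let _ := Classical.decEq (G.op o e).E
  rw [Finset.mul_sum]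
  refine Finset.sum_congr (Finset.ext fun t => ?_) fun t _ => ?_
  · exact iff_of_true (@Finset.mem_univ _ (_) t) (@Finset.mem_univ _ (_) t)
  rw [G.stateTerm_op w α β γ o e]
  · congr 2
    funext e'
    simp [Equiv.funSplitAt, Equiv.piSplitAt, e'.2]
  · simp [Equiv.funSplitAt, Equiv.piSplitAt]

theorem stateSum_edgeless {R : Type} [CommRing R] (w : EdgeOp → R) (α β γ : R)
    (h : IsEmpty G.E) :
    G.stateSum w α β γ = α ^ G.numV * β ^ G.numVtxClasses * γ ^ G.numBdyClasses := by
  have hτ : ∀ t, G.stateτ t = G.τ := fun t => by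
    funext p
    exact relink_off fun ⟨x, _⟩ => h.elim x.1
  unfold stateSum stateTerm
  simp only [hτ]
  simp
  rfl

end StateSum

/-- `F` satisfies the deletion-contraction relation with weights `a, b, c, x, y` for deletion,
contraction, Penrose-contraction, merge-deletion and merge-contraction, at every edge, and takes
the value `α ^ |V| * β ^ |𝒱| * γ ^ |ℬ|` on edgeless packaged arrow presentations. -/
def IsQ {R : Type} [CommRing R] (a b c x y α β γ : R) (F : Packaged → R) : Prop :=
  (∀ (G : Packaged) (e : G.E), F G = a * F (G.op .del e) + b * F (G.op .con e) +
    c * F (G.op .pen e) + x * F (G.op .mdel e) + y * F (G.op .mcon e)) ∧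
  ∀ G : Packaged, IsEmpty G.E → F G = α ^ G.numV * β ^ G.numVtxClasses * γ ^ G.numBdyClasses

/-- `F` satisfies the deletion-contraction relation with weights `a, b` for deletion and
contraction, at every edge, and takes the value `α ^ |V| * β ^ |𝒱| * γ ^ |ℬ|` on edgeless packaged
arrow presentations. -/
def IsZ {R : Type} [CommRing R] (a b α β γ : R) (F : Packaged → R) : Prop :=
  (∀ (G : Packaged) (e : G.E), F G = a * F (G.op .del e) + b * F (G.op .con e)) ∧
  ∀ G : Packaged, IsEmpty G.E → F G = α ^ G.numV * β ^ G.numVtxClasses * γ ^ G.numBdyClasses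

theorem card_op_lt (o : EdgeOp) (e : G.E) : Nat.card (G.op o e).E < Nat.card G.E :=
  Finite.card_subtype_lt (p := fun e' => e' ≠ e) (x := e) (by simp)

theorem induction_edges {P : Packaged → Prop}
    (h : ∀ G, (∀ (o : EdgeOp) (e : G.E), P (G.op o e)) → P G) (G : Packaged) : P G := by
  induction hn : Nat.card G.E using Nat.strong_induction_on generalizing G with
  | _ n ih =>
    subst hn
    exact h G fun o e => ih _ (G.card_op_lt o e) _ rfl

theorem IsQ.unique {R : Type} [CommRing R] {a b c x y α β γ : R} {F F' : Packaged → R}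
    (hF : IsQ a b c x y α β γ F) (hF' : IsQ a b c x y α β γ F') : F = F' := by
  funext G
  induction G using induction_edges with
  | _ G ih =>
    rcases isEmpty_or_nonempty G.E with h | ⟨⟨e⟩⟩
    · rw [hF.2 G h, hF'.2 G h]
    · rw [hF.1 G e, hF'.1 G e]
      simp only [ih]

theorem existsUnique_isQ {R : Type} [CommRing R] (a b c x y α β γ : R) :
    ∃! F : Packaged → R, IsQ a b c x y α β γ F := by
  have key : IsQ a b c x y α β γ (fun G => G.stateSum
      (fun | .del => a | .con => b | .pen => c | .mdel => x | .mcon => y) α β γ) := by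
    refine ⟨fun G e => ?_, fun G hG => G.stateSum_edgeless _ α β γ hG⟩
    change stateSum _ _ _ _ _ = _
    rw [G.stateSum_op _ α β γ e, show (Finset.univ : Finset EdgeOp) =
      {.del, .con, .pen, .mdel, .mcon} from rfl]
    simp [add_assoc]
  exact ⟨_, key, fun F hF => hF.unique key⟩

theorem existsUnique_isZ {R : Type} [CommRing R] (a b α β γ : R) :
    ∃! F : Packaged → R, IsZ a b α β γ F := by
  simpa [IsZ, IsQ] using existsUnique_isQ a b 0 0 0 α β γ

open MvPolynomial in
/-- The polynomial `Q(G; a, b, c, x, y, α, β, γ)`, with the variables numbered in this order: the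
unique solution of its deletion-contraction recursion. -/
def Q : Packaged → MvPolynomial (Fin 8) ℤ :=
  (existsUnique_isQ (X 0) (X 1) (X 2) (X 3) (X 4) (X 5) (X 6) (X 7)).choose

open MvPolynomial in
/-- The polynomial `Z(G; a, b, α, β, γ)`, with the variables numbered in this order: the unique
solution of its deletion-contraction recursion. -/
def Z : Packaged → MvPolynomial (Fin 5) ℤ :=
  (existsUnique_isZ (X 0) (X 1) (X 2) (X 3) (X 4)).choose

theorem isQ_Q : IsQ (.X 0) (.X 1) (.X 2) (.X 3) (.X 4) (.X 5) (.X 6) (.X 7) Q :=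
  (existsUnique_isQ _ _ _ _ _ _ _ _).choose_spec.1

theorem isZ_Z : IsZ (.X 0) (.X 1) (.X 2) (.X 3) (.X 4) Z :=
  (existsUnique_isZ _ _ _ _ _).choose_spec.1

/-- For `γ = 1`, solutions of the recursion do not depend on the boundary partition. -/
theorem IsQ.eq_of_toVertexPartitioned_eq {R : Type} [CommRing R] {a b c x y α β : R}
    {F : Packaged → R} (hF : IsQ a b c x y α β 1 F) (G G' : Packaged)
    (h : G.toVertexPartitioned = G'.toVertexPartitioned) : F G = F G' := by
  induction G using induction_edges generalizing G' with
  | _ G ih =>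
    obtain ⟨G, B, hB⟩ := G
    obtain ⟨G', B', hB'⟩ := G'
    subst h
    rcases isEmpty_or_nonempty G.E with h | ⟨⟨e⟩⟩
    · rw [hF.2 _ h, hF.2 _ h]
      simp only [one_pow]
      rfl
    · rw [hF.1 ⟨G, B, hB⟩ e, hF.1 ⟨G, B', hB'⟩ e, ih .del e (op ⟨G, B', hB'⟩ .del e) rfl,
        ih .con e (op ⟨G, B', hB'⟩ .con e) rfl, ih .pen e (op ⟨G, B', hB'⟩ .pen e) rfl,
        ih .mdel e (op ⟨G, B', hB'⟩ .mdel e) rfl, ih .mcon e (op ⟨G, B', hB'⟩ .mcon e) rfl]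

/-- The value `Q(G; a, b, c, x, y, α, β, γ)` at elements of a commutative ring. -/
def evalQ {R : Type} [CommRing R] (a b c x y α β γ : R) : R :=
  MvPolynomial.aeval ![a, b, c, x, y, α, β, γ] G.Q

/-- The value `Z(G; a, b, α, β, γ)` at elements of a commutative ring. -/
def evalZ {R : Type} [CommRing R] (a b α β γ : R) : R :=
  MvPolynomial.aeval ![a, b, α, β, γ] G.Z

theorem isQ_evalQ {R : Type} [CommRing R] (a b c x y α β γ : R) :
    IsQ a b c x y α β γ (fun G => G.evalQ a b c x y α β γ) := by
  refine ⟨fun G e => ?_, fun G h => ?_⟩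
  · simp [evalQ, isQ_Q.1 G e]
  · simp [evalQ, isQ_Q.2 G h]

theorem isZ_evalZ {R : Type} [CommRing R] (a b α β γ : R) :
    IsZ a b α β γ (fun G => G.evalZ a b α β γ) := by
  refine ⟨fun G e => ?_, fun G h => ?_⟩
  · simp [evalZ, isZ_Z.1 G e]
  · simp [evalZ, isZ_Z.2 G h]

end Packaged

namespace VertexPartitioned

variable (G : VertexPartitioned)

/-- The value of `Q̂(G; a, b, c, x, α, β) = Q(P; a, b, c, x, 0, α, β, 1)` at elements of a
commutative ring; here `P` is any packaged arrow presentation obtained from `G` by partitioning the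
boundary components (see `Qhat_eq`), for definiteness the one with a single boundary class. -/
def Qhat {R : Type} [CommRing R] (a b c x α β : R) : R :=
  G.pack.evalQ a b c x 0 α β 1

/-- The value of `Ẑ(G; a, b, α, β) = Z(P; a, b, α, β, 1)` at elements of a commutative ring; here
`P` is any packaged arrow presentation obtained from `G` by partitioning the boundary components
(see `Zhat_eq`), for definiteness the one with a single boundary class. -/
def Zhat {R : Type} [CommRing R] (a b α β : R) : R :=
  G.pack.evalZ a b α β 1

theorem Qhat_eq {R : Type} [CommRing R] (a b c x α β : R) (P : Packaged) :
    P.toVertexPartitioned.Qhat a b c x α β = P.evalQ a b c x 0 α β 1 :=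
  (Packaged.isQ_evalQ a b c x 0 α β 1).eq_of_toVertexPartitioned_eq _ _ rfl

theorem Zhat_eq {R : Type} [CommRing R] (a b α β : R) (P : Packaged) :
    P.toVertexPartitioned.Zhat a b α β = P.evalZ a b α β 1 := by
  have h : Packaged.IsQ a b 0 0 0 α β 1 (fun G => G.evalZ a b α β 1) := by
    simpa [Packaged.IsQ, Packaged.IsZ] using Packaged.isZ_evalZ a b α β 1
  exact h.eq_of_toVertexPartitioned_eq _ _ rfl

end VertexPartitioned

end

noncomputable section

/-! Both polynomials are state sums: a state assigns an operation to every edge and contributes the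
product of its weights times `α ^ #circles * β ^ #vertex classes`. At `γ = 1` the boundary partition
drops out.

Fix a state of `H` off `e` and cut out the two arrow arcs of `e`. What remains consists of closed
curves and of paths that join the four ends of `e` in pairs (`exists_other_end`, `exists_pairing`).
The three possible pairings are those of deletion, contraction and Penrose-contraction. The last two
join the two arrows by a path and so force their vertex classes to agree; under the first the
classes may agree or not. Hence, seen from `e`, the rest of `H` acts like one of deletion,
contraction, Penrose-contraction and merge-deletion: this is the type of the state
(`exists_stateType`). The solution of the system is `typeWeight`: for each type `o`, the sum over
the states of type `o`, counting only the circles and vertex classes that avoid `e`.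

In a 2-sum, a state of `H` of type `o` affects `G` as the operation `o` on `f` does, apart from the
circles and classes that avoid `e` (`card_stateCirc_twoSum`, `card_stateVtx_twoSum`). So the 2-sum
has the state sum of `G` with the weights at `f` replaced by the type weights
(`weightedSum_twoSum`). State sums with edge-dependent weights allow this to be iterated over all
edges of `G` (`weightedSum_sumList`).

Performing `o` on `e` in `H` closes up a state of type `o'` into two circles through `e` if the
pairings of `o` and `o'` agree and into one otherwise, with two vertex classes at `e` only if
neither `o` nor `o'` merges (`weightedSum_op`). These exponents are the entries of the matrix, whose
determinant does not vanish. -/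

/-! ### Paths and cycles traced by two involutions -/

theorem curveSetoid_left {P : Type} (f g : P → P) (p : P) : curveSetoid f g p (f p) :=
  Relation.EqvGen.rel _ _ (Or.inl rfl)

theorem curveSetoid_right {P : Type} (f g : P → P) (p : P) : curveSetoid f g p (g p) :=
  Relation.EqvGen.rel _ _ (Or.inr rfl)

/-- In a finite union of paths and cycles, the path that starts at `x` has exactly one other end. -/
theorem exists_other_end {P : Type} [Finite P] {σ τ : P → P} (hσ : Function.Involutive σ)
    (hσ' : ∀ p, σ p ≠ p) (hτ : Function.Involutive τ) (x : P) (hx : τ x = x) :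
    ∃ y, τ y = y ∧ y ≠ x ∧ curveSetoid σ τ x y ∧
      ∀ z, τ z = z → curveSetoid σ τ x z → z = x ∨ z = y := by
  let s : Equiv.Perm P := hσ.toPerm
  let t : Equiv.Perm P := hτ.toPerm
  -- Two steps along the path are one application of `g`. Since `τ` fixes `x`, the involutions act
  -- on the points `g ^ n x` by reflecting exponents: `τ` by `n ↦ -n` and `σ` by `n ↦ 1 - n`.
  let g : Equiv.Perm P := s * t
  have hss : s * s = 1 := Equiv.ext hσ
  have htt : t * t = 1 := Equiv.ext hτ
  have hsi : s⁻¹ = s := inv_eq_of_mul_eq_one_left hss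
  have hti : t⁻¹ = t := inv_eq_of_mul_eq_one_left htt
  have hg : g⁻¹ = t * s := by rw [mul_inv_rev, hsi, hti]
  have hconj : ∀ n : ℤ, t * g ^ n = g ^ (-n) * t := by
    intro n
    have h : t * g * t⁻¹ = g⁻¹ := by
      rw [hg, hti]
      calc t * (s * t) * t = t * s * (t * t) := by group
        _ = t * s := by rw [htt, mul_one]
    have h2 : t * g ^ n * t⁻¹ = g ^ (-n) := by
      rw [← conj_zpow, h, inv_zpow, zpow_neg]
    rw [← h2, inv_mul_cancel_right]
  have htx : t x = x := hx
  have hτg : ∀ n : ℤ, τ ((g ^ n) x) = (g ^ (-n)) x := by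
    intro n
    calc τ ((g ^ n) x) = (t * g ^ n) x := rfl
      _ = (g ^ (-n) * t) x := by rw [hconj]
      _ = (g ^ (-n)) x := congrArg _ htx
  have hσg : ∀ n : ℤ, σ ((g ^ n) x) = (g ^ (1 - n)) x := by
    intro n
    rw [sub_eq_add_neg, zpow_add, zpow_one, Equiv.Perm.mul_apply, ← hτg]
    change _ = s (t (τ _))
    change _ = σ (τ (τ _))
    rw [hτ]
  have hrel : ∀ z, curveSetoid σ τ x z → ∃ n : ℤ, z = (g ^ n) x := by
    let r : Setoid P := Setoid.mk (fun p q => (∃ n : ℤ, p = (g ^ n) x) ↔ ∃ n : ℤ, q = (g ^ n) x)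
      ⟨fun _ => Iff.rfl, fun h => h.symm, fun h h' => h.trans h'⟩
    have hσm : ∀ p, (∃ n : ℤ, p = (g ^ n) x) → ∃ n : ℤ, σ p = (g ^ n) x := by
      rintro _ ⟨n, rfl⟩
      exact ⟨_, hσg n⟩
    have hτm : ∀ p, (∃ n : ℤ, p = (g ^ n) x) → ∃ n : ℤ, τ p = (g ^ n) x := by
      rintro _ ⟨n, rfl⟩
      exact ⟨_, hτg n⟩
    have hr : curveSetoid σ τ ≤ r := curveSetoid_le_iff.2 fun p =>
      ⟨⟨hσm p, fun h => by simpa [hσ p] using hσm _ h⟩,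
        ⟨hτm p, fun h => by simpa [hτ p] using hτm _ h⟩⟩
    exact fun z hz => (hr hz).1 ⟨0, rfl⟩
  have hmem : ∀ n : ℕ, curveSetoid σ τ x ((g ^ n) x) := by
    intro n
    induction n with
    | zero => exact Setoid.refl' _ _
    | succ n ih =>
      rw [pow_succ']
      exact Setoid.trans' _ ih (Setoid.trans' _ (curveSetoid_right σ τ _) (curveSetoid_left σ τ _))
  set N := Function.minimalPeriod (g • ·) x with hN
  have hdvd : ∀ m n : ℤ, (g ^ m) x = (g ^ n) x ↔ (N : ℤ) ∣ m - n := by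
    intro m n
    rw [hN, ← MulAction.zpow_smul_eq_iff_minimalPeriod_dvd, sub_eq_neg_add, zpow_add, zpow_neg,
      Equiv.Perm.smul_def, Equiv.Perm.mul_apply, Equiv.Perm.inv_eq_iff_eq]
  have hNpos : 0 < N := by
    refine Function.minimalPeriod_pos_of_mem_periodicPts ?_
    refine ⟨orderOf g, orderOf_pos g, ?_⟩
    rw [Function.IsPeriodicPt, Function.IsFixedPt, smul_iterate, pow_orderOf_eq_one]
    exact one_smul _ x
  -- For `N = 2 * k + 1` the reflection `n ↦ 1 - n` modulo `N` fixes `k + 1`, but `σ` has no fixed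
  -- point.
  have heven : Even N := by
    by_contra h
    obtain ⟨k, hk⟩ := Nat.not_even_iff_odd.1 h
    refine hσ' ((g ^ (k + 1 : ℤ)) x) ?_
    rw [hσg, hdvd, hk]
    exact ⟨-1, by push_cast; ring⟩
  obtain ⟨k, hk⟩ := heven
  -- Modulo `N = 2 * k`, the fixed exponents of `n ↦ -n` are `0` and `k`; these are the two ends.
  refine ⟨(g ^ (k : ℤ)) x, ?_, ?_, by simpa using hmem k, ?_⟩
  · rw [hτg, hdvd, hk]
    exact ⟨-1, by push_cast; ring⟩
  · intro h
    obtain ⟨c, hc⟩ := (hdvd k 0).1 h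
    rw [hk] at hc
    push_cast at hc
    have : (k : ℤ) * (2 * c - 1) = 0 := by linarith
    rcases mul_eq_zero.1 this with h | h <;> omega
  · intro z hz hxz
    obtain ⟨n, rfl⟩ := hrel z hxz
    rw [hτg, hdvd] at hz
    obtain ⟨c, hc⟩ := hz
    rw [hk] at hc
    push_cast at hc
    have hn : n = -(k * c) := by linarith
    rcases Int.even_or_odd' c with ⟨d, rfl | rfl⟩
    · left
      refine (hdvd n 0).2 ?_
      rw [hk, hn]
      exact ⟨-d, by push_cast; ring⟩
    · right
      rw [hdvd, hk, hn]
      exact ⟨-d - 1, by push_cast; ring⟩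

/-! ### Counting classes after gluing and merging -/

/-- The disjoint union of `S` and `R`, with the class of `j i` merged with that of `p i`. -/
def glue {P Q I : Type} (S : Setoid P) (R : Setoid Q) (j : I → P) (p : I → Q) : Setoid (P ⊕ Q) :=
  Relation.EqvGen.setoid fun a b =>
    (∃ x y, S x y ∧ a = .inl x ∧ b = .inl y) ∨ (∃ x y, R x y ∧ a = .inr x ∧ b = .inr y) ∨
      ∃ i, a = .inl (j i) ∧ b = .inr (p i)

theorem glue_le_iff {P Q I : Type} {S : Setoid P} {R : Setoid Q} {j : I → P} {p : I → Q}
    {T : Setoid (P ⊕ Q)} : glue S R j p ≤ T ↔ S ≤ T.comap .inl ∧ R ≤ T.comap .inr ∧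
      ∀ i, T (.inl (j i)) (.inr (p i)) := by
  constructor
  · intro h
    exact ⟨fun x y hxy => h (Relation.EqvGen.rel _ _ (Or.inl ⟨x, y, hxy, rfl, rfl⟩)),
      fun x y hxy => h (Relation.EqvGen.rel _ _ (Or.inr (Or.inl ⟨x, y, hxy, rfl, rfl⟩))),
      fun i => h (Relation.EqvGen.rel _ _ (Or.inr (Or.inr ⟨i, rfl, rfl⟩)))⟩
  · rintro ⟨h1, h2, h3⟩
    refine Setoid.eqvGen_le ?_
    rintro _ _ (⟨x, y, h, rfl, rfl⟩ | ⟨x, y, h, rfl, rfl⟩ | ⟨i, rfl, rfl⟩)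
    exacts [h1 h, h2 h, h3 i]

/-- `S` with the classes of `j i` and `j i'` merged whenever `r i i'`. -/
def mergeAlong {P I : Type} (S : Setoid P) (j : I → P) (r : I → I → Prop) : Setoid P :=
  S ⊔ Relation.EqvGen.setoid fun a b => ∃ i i', r i i' ∧ a = j i ∧ b = j i'

theorem mergeAlong_le_iff {P I : Type} {S T : Setoid P} {j : I → P} {r : I → I → Prop} :
    mergeAlong S j r ≤ T ↔ S ≤ T ∧ ∀ i i', r i i' → T (j i) (j i') := by
  rw [mergeAlong, sup_le_iff]
  refine and_congr_right fun _ => ⟨fun h i i' hr => ?_, fun h => Setoid.eqvGen_le ?_⟩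
  · exact h (Relation.EqvGen.rel _ _ ⟨i, i', hr, rfl, rfl⟩)
  · rintro _ _ ⟨i, i', hr, rfl, rfl⟩
    exact h i i' hr

/-- The number of classes of `R` that do not meet the range of `p`. -/
def freeClasses {Q I : Type} (R : Setoid Q) (p : I → Q) : ℕ :=
  Nat.card {c : Quotient R // ∀ i, c ≠ Quotient.mk R (p i)}

/-- A class of `R` that meets the range of `p` is absorbed into the part coming from `S`; the others
survive unchanged. Thus `R` matters only through its free classes and its trace on `I`. The map `F`
carries this out, and its kernel is the glued relation. -/
theorem card_quotient_glue {P Q I : Type} [Finite P] [Finite Q] (S : Setoid P) (R : Setoid Q)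
    (j : I → P) (p : I → Q) :
    Nat.card (Quotient (glue S R j p)) =
      freeClasses R p + Nat.card (Quotient (mergeAlong S j fun i i' => R (p i) (p i'))) := by
  classical
  set S' := mergeAlong S j fun i i' => R (p i) (p i')
  obtain ⟨hS, hj⟩ := mergeAlong_le_iff.1 (le_refl S')
  obtain ⟨gS, gR, gj⟩ := glue_le_iff.1 (le_refl (glue S R j p))
  let F : P ⊕ Q → {c : Quotient R // ∀ i, c ≠ Quotient.mk R (p i)} ⊕ Quotient S' := fun a =>
    match a with
    | .inl x => .inr (Quotient.mk _ x)
    | .inr q => if h : ∃ i, R q (p i) then .inr (Quotient.mk _ (j h.choose)) else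
        .inl ⟨Quotient.mk _ q, fun i hi => h ⟨i, Quotient.exact hi⟩⟩
  have hF : ∀ q i, R q (p i) → F (.inr q) = .inr (Quotient.mk _ (j i)) := by
    intro q i hi
    have h : ∃ i, R q (p i) := ⟨i, hi⟩
    simp only [F, dif_pos h]
    exact congrArg _ (Quotient.sound (hj _ _ (Setoid.trans' _ (Setoid.symm' _ h.choose_spec) hi)))
  have hF' : ∀ q (h : ¬ ∃ i, R q (p i)), F (.inr q) =
      .inl ⟨Quotient.mk _ q, fun i hi => h ⟨i, Quotient.exact hi⟩⟩ := fun q h => dif_neg h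
  have hsurj : Function.Surjective F := by
    rintro (⟨c, hc⟩ | c)
    · induction c using Quotient.inductionOn with
      | _ q => exact ⟨.inr q, hF' q fun ⟨i, hi⟩ => hc i (Quotient.sound hi)⟩
    · induction c using Quotient.inductionOn with
      | _ x => exact ⟨.inl x, rfl⟩
  have hker : glue S R j p = Setoid.ker F := by
    refine le_antisymm (glue_le_iff.2 ⟨fun x y h => ?_, fun x y h => ?_, fun i => ?_⟩) ?_
    · exact congrArg _ (Quotient.sound (hS h))
    · change F (.inr x) = F (.inr y)
      by_cases hy : ∃ i, R y (p i)
      · obtain ⟨i, hi⟩ := hy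
        rw [hF y i hi, hF x i (Setoid.trans' _ h hi)]
      · have hx : ¬ ∃ i, R x (p i) := fun ⟨i, hi⟩ =>
          hy ⟨i, Setoid.trans' _ (Setoid.symm' _ h) hi⟩
        rw [hF' y hy, hF' x hx]
        exact congrArg _ (Subtype.ext (Quotient.sound h))
    · exact (hF _ i (Setoid.refl' _ _)).symm
    · have hS' : S' ≤ (glue S R j p).comap .inl := mergeAlong_le_iff.2 ⟨gS, fun i i' h =>
        Setoid.trans' (glue S R j p) (gj i) (Setoid.trans' (glue S R j p) (gR h)
          (Setoid.symm' _ (gj i')))⟩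
      have key : ∀ a, (∃ x, glue S R j p a (.inl x) ∧ F a = .inr (Quotient.mk _ x)) ∨
          ∃ q h, a = .inr q ∧ F a = .inl ⟨Quotient.mk _ q, h⟩ := by
        rintro (x | q)
        · exact Or.inl ⟨x, Setoid.refl' _ _, rfl⟩
        · by_cases h : ∃ i, R q (p i)
          · obtain ⟨i, hi⟩ := h
            exact Or.inl ⟨j i, Setoid.trans' _ (gR hi) (Setoid.symm' _ (gj i)), hF q i hi⟩
          · exact Or.inr ⟨q, _, rfl, hF' q h⟩
      intro a b (hab : F a = F b)
      rcases key a with ⟨x, hx, hx'⟩ | ⟨q, hq, rfl, hq'⟩ <;>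
        rcases key b with ⟨y, hy, hy'⟩ | ⟨r, hr, rfl, hr'⟩
      · rw [hx', hy'] at hab
        exact Setoid.trans' _ hx (Setoid.trans' _ (hS' (Quotient.exact (Sum.inr_injective hab)))
          (Setoid.symm' _ hy))
      · rw [hx', hr'] at hab
        cases hab
      · rw [hq', hy'] at hab
        cases hab
      · rw [hq', hr'] at hab
        exact gR (Quotient.exact (congrArg Subtype.val (Sum.inl_injective hab)))
  rw [hker, Nat.card_congr (Setoid.quotientKerEquivOfSurjective F hsurj), Nat.card_sum]
  rfl

/-- Merging classes of `R` along a relation on an index set. -/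
theorem card_quotient_mergeAlong {Q I : Type} [Finite I] [Finite Q] (S : Setoid I) (R : Setoid Q)
    (p : I → Q) : Nat.card (Quotient (mergeAlong R p S)) =
      freeClasses R p + Nat.card (Quotient (mergeAlong S id fun i i' => R (p i) (p i'))) := by
  -- With `j = id`, every point of `I` is attached to a point of `Q`, so the glued classes are those
  -- of `R` merged along `S`.
  rw [← card_quotient_glue S R id p]
  obtain ⟨gS, gR, gj⟩ := glue_le_iff.1 (le_refl (glue S R id p))
  obtain ⟨hS, hj⟩ := mergeAlong_le_iff.1 (le_refl (mergeAlong R p S))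
  refine Nat.card_congr ⟨Quotient.map Sum.inr fun a b h => ?_, Quotient.map (Sum.elim p id)
    fun a b h => ?_, ?_, ?_⟩
  · exact (mergeAlong_le_iff (T := (glue S R id p).comap .inr)).2 ⟨gR, fun i i' h =>
      Setoid.trans' (glue S R id p) (Setoid.symm' _ (gj i))
        (Setoid.trans' (glue S R id p) (gS h) (gj i'))⟩ h
  · exact (glue_le_iff (T := (mergeAlong R p S).comap (Sum.elim p id))).2
      ⟨fun i i' h => hj i i' h, fun x y h => hS h, fun i => Setoid.refl' (mergeAlong R p S) (p i)⟩ h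
  · intro c
    induction c using Quotient.inductionOn with
    | _ q => rfl
  · intro c
    induction c using Quotient.inductionOn with
    | _ a =>
      rcases a with i | q
      · exact Quotient.sound (Setoid.symm' _ (gj i))
      · rfl

theorem mergeAlong_rel {P I : Type} {S : Setoid P} {j : I → P} {r : I → I → Prop} {i i' : I}
    (h : r i i') : mergeAlong S j r (j i) (j i') :=
  (mergeAlong_le_iff.1 le_rfl).2 i i' h

theorem le_mergeAlong {P I : Type} (S : Setoid P) (j : I → P) (r : I → I → Prop) :
    S ≤ mergeAlong S j r :=
  le_sup_left

/-! ### Cutting curves at an edge and rejoining the ends -/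

/-- `relink τ p id` fixes each `p x`, so it describes the curves cut open at these points. Any way
of rejoining the ends only merges classes of the cut curves, which isolates the dependence on
`link`. -/
theorem curveSetoid_relink {ι P : Type} {σ τ : P → P} {p : ι → P} (hp : Function.Injective p)
    (link : ι → ι) : curveSetoid σ (relink τ p link) =
      mergeAlong (curveSetoid σ (relink τ p id)) p (fun x y => y = link x) := by
  refine le_antisymm (curveSetoid_le_iff.2 fun q => ⟨?_, ?_⟩) (mergeAlong_le_iff.2
    ⟨curveSetoid_le_iff.2 fun q => ⟨curveSetoid_left _ _ q, ?_⟩, ?_⟩)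
  · exact le_mergeAlong _ _ _ (curveSetoid_left _ _ q)
  · by_cases h : ∃ x, p x = q
    · obtain ⟨x, rfl⟩ := h
      rw [relink_pts hp]
      exact mergeAlong_rel rfl
    · have := le_mergeAlong _ p (fun x y => y = link x) (curveSetoid_right σ (relink τ p id) q)
      rwa [relink_off h] at this ⊢
  · by_cases h : ∃ x, p x = q
    · obtain ⟨x, rfl⟩ := h
      rw [relink_pts hp]
      exact Setoid.refl' _ _
    · have := curveSetoid_right σ (relink τ p link) q
      rwa [relink_off h] at this ⊢
  · rintro x _ rfl
    have := curveSetoid_right σ (relink τ p link) (p x)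
    rwa [relink_pts hp] at this

/-- The joins of a 2-sum all run between the two sides, so the curves are those of both sides, cut
open at the edges and then glued end to end. -/
theorem curveSetoid_relink_sum {P Q : Type} {σ τ : P → P} {σ' τ' : Q → Q}
    {p : Bool × Bool → P} {q : Bool × Bool → Q} (hp : Function.Injective p)
    (hq : Function.Injective q) (φ : Bool ≃ Bool) :
    curveSetoid (Sum.map σ σ') (relink (Sum.map τ τ') (Sum.map p q)
      (ArrowPresentation.sumLink φ)) =
    glue (curveSetoid σ (relink τ p id)) (curveSetoid σ' (relink τ' q id)) p
      (fun x => q (φ x.1, x.2)) := by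
  obtain ⟨gS, gR, gj⟩ := glue_le_iff.1 (le_refl (glue (curveSetoid σ (relink τ p id))
    (curveSetoid σ' (relink τ' q id)) p (fun x => q (φ x.1, x.2))))
  have hpq : Function.Injective (Sum.map p q) := hp.sumMap hq
  refine le_antisymm (curveSetoid_le_iff.2 ?_) (glue_le_iff.2
    ⟨curveSetoid_le_iff.2 fun a => ⟨?_, ?_⟩, curveSetoid_le_iff.2 fun a => ⟨?_, ?_⟩, fun x => ?_⟩)
  · rintro (a | a)
    · refine ⟨gS (curveSetoid_left _ _ a), ?_⟩
      by_cases h : ∃ x, p x = a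
      · obtain ⟨x, rfl⟩ := h
        rw [show (Sum.inl (p x) : P ⊕ Q) = Sum.map p q (.inl x) from rfl, relink_pts hpq]
        exact gj x
      · have := gS (curveSetoid_right _ _ a)
        rw [relink_off h] at this
        rw [relink_off]
        · exact this
        · rintro ⟨x | x, hx⟩
          · exact h ⟨x, Sum.inl_injective hx⟩
          · cases hx
    · refine ⟨gR (curveSetoid_left _ _ a), ?_⟩
      by_cases h : ∃ x, q x = a
      · obtain ⟨x, rfl⟩ := h
        rw [show (Sum.inr (q x) : P ⊕ Q) = Sum.map p q (.inr x) from rfl, relink_pts hpq]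
        have := gj (φ.symm x.1, x.2)
        simp only [Equiv.apply_symm_apply] at this
        exact Setoid.symm' _ this
      · have := gR (curveSetoid_right _ _ a)
        rw [relink_off h] at this
        rw [relink_off]
        · exact this
        · rintro ⟨x | x, hx⟩
          · cases hx
          · exact h ⟨x, Sum.inr_injective hx⟩
  · exact curveSetoid_left (Sum.map σ σ') _ (.inl a)
  · by_cases h : ∃ x, p x = a
    · obtain ⟨x, rfl⟩ := h
      rw [relink_pts hp]
      exact Setoid.refl' _ _
    · have := curveSetoid_right (Sum.map σ σ') (relink (Sum.map τ τ') (Sum.map p q)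
        (ArrowPresentation.sumLink φ)) (.inl a)
      rw [relink_off] at this
      · rwa [relink_off h]
      · rintro ⟨x | x, hx⟩
        · exact h ⟨x, Sum.inl_injective hx⟩
        · cases hx
  · exact curveSetoid_left (Sum.map σ σ') _ (.inr a)
  · by_cases h : ∃ x, q x = a
    · obtain ⟨x, rfl⟩ := h
      rw [relink_pts hq]
      exact Setoid.refl' _ _
    · have := curveSetoid_right (Sum.map σ σ') (relink (Sum.map τ τ') (Sum.map p q)
        (ArrowPresentation.sumLink φ)) (.inr a)
      rw [relink_off] at this
      · rwa [relink_off h]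
      · rintro ⟨x | x, hx⟩
        · cases hx
        · exact h ⟨x, Sum.inr_injective hx⟩
  · have := curveSetoid_right (Sum.map σ σ') (relink (Sum.map τ τ') (Sum.map p q)
      (ArrowPresentation.sumLink φ)) (Sum.map p q (.inl x))
    rw [relink_pts hpq] at this
    exact this

/-! ### Pairings of the four ends of an edge, and merging of its two arrows -/

set_option synthInstance.maxSize 2000 in
set_option maxRecDepth 20000 in
-- Four points have only three perfect matchings, and the three smoothings realize them.
theorem exists_smoothing_eq {π : Bool × Bool → Bool × Bool} (h : Function.Involutive π)
    (h' : ∀ x, π x ≠ x) : ∃ k : Smoothing, π = k.link := by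
  have key : ∀ π : Bool × Bool → Bool × Bool, (∀ x, π (π x) = x) → (∀ x, π x ≠ x) →
      (∀ x, π x = Smoothing.del.link x) ∨ (∀ x, π x = Smoothing.con.link x) ∨
      ∀ x, π x = Smoothing.pen.link x := by decide
  rcases key π h h' with h | h | h
  exacts [⟨_, funext h⟩, ⟨_, funext h⟩, ⟨_, funext h⟩]

/-- The ends of the arrows of an edge are joined in pairs by the curves outside of these arrows. -/
theorem exists_pairing {P : Type} [Finite P] {σ τ : P → P} {p : Bool × Bool → P}
    (hσ : Function.Involutive σ) (hσ' : ∀ q, σ q ≠ q) (hτ : Function.Involutive τ)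
    (hτ' : ∀ q, τ q ≠ q) (hp : Function.Injective p) (hr : ∀ x, ∃ y, τ (p x) = p y) :
    ∃ k : Smoothing, ∀ x y,
      curveSetoid σ (relink τ p id) (p x) (p y) ↔ y = x ∨ y = k.link x := by
  -- Since `τ` has no fixed points, the cut curves end only at the points `p x`; each path therefore
  -- pairs two of them.
  have hfix : ∀ q, relink τ p id q = q → ∃ x, p x = q := by
    intro q hq
    by_contra h
    rw [relink_off h] at hq
    exact hτ' q hq
  have hex : ∀ x, ∃ y, y ≠ x ∧ ∀ z, curveSetoid σ (relink τ p id) (p x) (p z) ↔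
      z = x ∨ z = y := by
    intro x
    obtain ⟨q, hq, hqx, hxq, h⟩ := exists_other_end hσ hσ'
      (relink_involutive hp (fun _ => rfl) hτ hr) (p x) (relink_pts (link := id) hp x)
    obtain ⟨y, rfl⟩ := hfix q hq
    refine ⟨y, fun h => hqx (congrArg p h), fun z => ⟨fun hz => ?_, ?_⟩⟩
    · exact (h (p z) (relink_pts (link := id) hp z) hz).imp (fun h => hp h) (fun h => hp h)
    · rintro (rfl | rfl)
      exacts [Setoid.refl' _ _, hxq]
  choose π hπ hπ' using hex
  obtain ⟨k, rfl⟩ := exists_smoothing_eq (π := π) (fun x => by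
    have h := (hπ' (π x) x).1 (Setoid.symm' _ ((hπ' x (π x)).2 (Or.inr rfl)))
    exact (h.resolve_left fun h => hπ x h.symm).symm) hπ
  exact ⟨k, hπ'⟩

/-- All three pairings are invariant under exchanging the two arrows. This is why the couplings do
not affect the result. -/
theorem Smoothing.link_comm (k : Smoothing) (φ : Bool ≃ Bool) (x : Bool × Bool) :
    k.link (φ x.1, x.2) = (φ (k.link x).1, (k.link x).2) := by
  have h : ∀ i, φ (!i) = !φ i := by
    intro i
    have : φ (!i) ≠ φ i := fun h => by simpa using φ.injective h
    revert this
    cases φ (!i) <;> cases φ i <;> simp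
  obtain ⟨i, s⟩ := x
  cases k <;> simp [Smoothing.link, h]

open Classical in
-- The union of two perfect matchings of four points is two doubled edges if they coincide and a
-- single 4-cycle otherwise. This yields the exponents of `α` in the system.
theorem card_quotient_pairings (k k' : Smoothing) :
    Nat.card (Quotient (mergeAlong (mergeAlong (⊥ : Setoid (Bool × Bool)) id
      (fun x y => y = k'.link x)) id (fun x y => y = x ∨ y = k.link x))) =
      if k = k' then 2 else 1 := by
  set T := mergeAlong (mergeAlong (⊥ : Setoid (Bool × Bool)) id
      (fun x y => y = k'.link x)) id (fun x y => y = x ∨ y = k.link x) with hT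
  have h1 : ∀ x, T x (k.link x) := fun x => mergeAlong_rel (j := id) (Or.inr rfl)
  have h2 : ∀ x, T x (k'.link x) := fun x =>
    le_mergeAlong _ _ _ (mergeAlong_rel (j := id) rfl)
  split_ifs with h
  · subst h
    let S : Setoid (Bool × Bool) := ⟨fun x y => y = x ∨ y = k.link x, fun x => Or.inl rfl,
      by cases k <;> decide, by cases k <;> decide⟩
    have : T = S := le_antisymm (mergeAlong_le_iff.2 ⟨mergeAlong_le_iff.2 ⟨bot_le, fun x y h =>
      Or.inr h⟩, fun x y h => h⟩) fun x y h => by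
        rcases h with rfl | rfl
        exacts [Setoid.refl' _ _, h1 x]
    rw [this]
    let _ : DecidableRel S.r := fun x y => inferInstanceAs (Decidable (y = x ∨ y = k.link x))
    rw [Nat.card_eq_fintype_card]
    cases k <;> rfl
  · have : ∀ x y, T x y := by
      intro x y
      have : y = x ∨ y = k.link x ∨ y = k'.link x ∨ y = k.link (k'.link x) := by
        revert x y
        cases k <;> cases k' <;> first | exact absurd rfl h | decide
      rcases this with rfl | rfl | rfl | rfl
      exacts [Setoid.refl' _ _, h1 _, h2 _, Setoid.trans' _ (h2 _) (h1 _)]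
    have : Subsingleton (Quotient T) := ⟨fun a b => by
      induction a using Quotient.inductionOn
      induction b using Quotient.inductionOn
      exact Quotient.sound (this _ _)⟩
    exact Nat.card_of_subsingleton (Quotient.mk T (false, false))

/-- Lets `card_quotient_mergeAlong`, which merges along an equivalence relation, apply to the bare
relation `y = link x`. -/
theorem mergeAlong_mergeAlong_bot {Q I : Type} (R : Setoid Q) (p : I → Q) (r : I → I → Prop) :
    mergeAlong R p (mergeAlong ⊥ id r) = mergeAlong R p r := by
  refine le_antisymm (mergeAlong_le_iff.2 ⟨le_mergeAlong _ _ _, fun i i' h => ?_⟩)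
    (mergeAlong_le_iff.2 ⟨le_mergeAlong _ _ _, fun i i' h =>
      mergeAlong_rel (mergeAlong_rel (j := id) h)⟩)
  exact (mergeAlong_le_iff (T := (mergeAlong R p r).comap p)).2
    ⟨bot_le, fun i i' h => mergeAlong_rel h⟩ h

theorem Setoid.rel_bool_iff {Q : Type} (R : Setoid Q) (p : Bool → Q) (i i' : Bool) :
    R (p i) (p i') ↔ i = i' ∨ R (p false) (p true) := by
  cases i <;> cases i' <;> simp [Setoid.comm' R (x := p true)]

/-- The relation on the two arrows of an edge that merges them if `m` holds. -/
def boolSetoid (m : Prop) : Setoid Bool where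
  r i i' := i = i' ∨ m
  iseqv := ⟨fun _ => Or.inl rfl, fun h => h.imp_left Eq.symm, fun h h' => by
    rcases h with rfl | h
    exacts [h', Or.inr h]⟩

open Classical in
theorem card_quotient_boolSetoid (m : Prop) :
    Nat.card (Quotient (boolSetoid m)) = if m then 1 else 2 := by
  split_ifs with h
  · have : Subsingleton (Quotient (boolSetoid m)) := ⟨fun a b => by
      induction a using Quotient.inductionOn
      induction b using Quotient.inductionOn
      exact Quotient.sound (Or.inr h)⟩
    exact Nat.card_of_subsingleton (Quotient.mk (boolSetoid m) false)
  · have : boolSetoid m = ⊥ := le_bot_iff.1 fun i i' hi => hi.resolve_right h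
    rw [this, ← Nat.card_congr (Equiv.ofBijective (Quotient.mk (⊥ : Setoid Bool))
      ⟨fun a b h => Quotient.exact h, Quotient.mk_surjective⟩)]
    simp

theorem mergeAlong_boolSetoid {Q : Type} (m : Prop) (R : Setoid Q) (p : Bool → Q) :
    mergeAlong (boolSetoid m) id (fun i i' => R (p i) (p i')) =
      boolSetoid (m ∨ R (p false) (p true)) := by
  refine le_antisymm (mergeAlong_le_iff.2 ⟨fun i i' h => h.imp_right Or.inl, fun i i' h =>
    ((R.rel_bool_iff p i i').1 h).imp_right Or.inr⟩) fun i i' h => ?_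
  rcases h with rfl | h | h
  · exact Setoid.refl' _ _
  · exact le_mergeAlong _ _ _ (Or.inr h)
  · exact mergeAlong_rel (j := id) ((R.rel_bool_iff p i i').2 (Or.inr h))

/-! ### Changing a state at one edge -/

namespace Packaged

variable (G : Packaged)

theorem stateτ_arrow (t : G.E → EdgeOp) (x : G.E × Bool × Bool) :
    G.stateτ t (G.arrow x) = G.arrow (x.1, (t x.1).smoothing.link x.2) :=
  relink_pts G.arrow_injective x

theorem stateτ_off (t : G.E → EdgeOp) {p : G.Pt} (h : ¬ ∃ x, G.arrow x = p) :
    G.stateτ t p = G.τ p :=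
  relink_off h

theorem stateτ_involutive (t : G.E → EdgeOp) : Function.Involutive (G.stateτ t) :=
  relink_involutive G.arrow_injective
    (fun x => Prod.ext rfl ((t x.1).smoothing.link_involutive x.2)) G.τ_involutive
    fun x => ⟨(x.1, x.2.1, !x.2.2), G.τ_arrow _ _ _⟩

theorem stateτ_ne (t : G.E → EdgeOp) (p : G.Pt) : G.stateτ t p ≠ p :=
  relink_ne G.arrow_injective
    (fun x h => (t x.1).smoothing.link_ne x.2 (congrArg Prod.snd h)) G.τ_ne p

open Classical in
theorem stateτ_update (t : G.E → EdgeOp) (e : G.E) (o : EdgeOp) :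
    G.stateτ (Function.update t e o) = relink (G.stateτ t) (G.ends e) o.smoothing.link := by
  funext p
  by_cases h : ∃ x, G.arrow x = p
  · obtain ⟨⟨e', x⟩, rfl⟩ := h
    rw [stateτ_arrow]
    by_cases he : e' = e
    · subst he
      rw [Function.update_self]
      exact (relink_pts (G.ends_injective e') x).symm
    · rw [Function.update_of_ne he, relink_off, stateτ_arrow]
      rintro ⟨y, hy⟩
      exact G.ends_ne he y x hy
  · rw [stateτ_off _ _ h, relink_off, stateτ_off _ _ h]
    rintro ⟨y, hy⟩
    exact h ⟨_, hy⟩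

end Packaged

/-! ### Circles and vertex classes of a state, and its type at an edge -/

namespace VertexPartitioned

variable (G : VertexPartitioned)

/-- The circles after applying the operation `t e` to each edge `e`. -/
def stateCirc (t : G.E → EdgeOp) : Setoid G.Pt :=
  curveSetoid G.σ (G.pack.stateτ t)

/-- The vertex partition after applying the operation `t e` to each edge `e`. -/
def stateVtx (t : G.E → EdgeOp) : Setoid G.Pt :=
  G.vtx ⊔ ⨆ e, G.pack.vtxRel (t e) e

/-- The curves that remain after applying `t e'` to each edge `e' ≠ e` and removing the arrow arcs
of `e`. -/
def stateOpen (t : G.E → EdgeOp) (e : G.E) : Setoid G.Pt :=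
  curveSetoid G.σ (relink (G.pack.stateτ t) (G.ends e) id)

theorem vtx_arrow (e : G.E) (i s s' : Bool) : G.vtx (G.arrow (e, i, s)) (G.arrow (e, i, s')) := by
  have h := G.vtx_τ (G.arrow (e, i, s))
  rw [G.τ_arrow] at h
  by_cases hs : s' = s
  · subst hs; exact Setoid.refl' _ _
  · rwa [show (!s) = s' by cases s <;> cases s' <;> simp_all] at h

theorem stateVtx_le_iff {t : G.E → EdgeOp} {T : Setoid G.Pt} : G.stateVtx t ≤ T ↔
    G.vtx ≤ T ∧ ∀ e, (t e).mergeVtx → T (G.arrow (e, false, false)) (G.arrow (e, true, false)) := by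
  rw [stateVtx, sup_le_iff, iSup_le_iff]
  refine and_congr_right fun _ => forall_congr' fun e => ?_
  unfold Packaged.vtxRel
  split_ifs with h
  · refine ⟨fun h' _ => h' (Relation.EqvGen.rel _ _ ⟨rfl, rfl⟩), fun h' => Setoid.eqvGen_le ?_⟩
    rintro _ _ ⟨rfl, rfl⟩
    exact h' h
  · simp [h]

theorem vtx_le_stateVtx (t : G.E → EdgeOp) : G.vtx ≤ G.stateVtx t := le_sup_left

theorem stateVtx_arrow {t : G.E → EdgeOp} {e : G.E} (h : (t e).mergeVtx) :
    G.stateVtx t (G.arrow (e, false, false)) (G.arrow (e, true, false)) :=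
  (G.stateVtx_le_iff.1 le_rfl).2 e h

open Classical in
-- Deletion merges nothing, so setting the value at `e` to `.del` leaves out the contribution of
-- `e`; the operation `o` then adds at most one merge.
theorem stateVtx_update (t : G.E → EdgeOp) (e : G.E) (o : EdgeOp) :
    G.stateVtx (Function.update t e o) = mergeAlong (G.stateVtx (Function.update t e .del))
      (fun i => G.arrow (e, i, false)) (boolSetoid o.mergeVtx) := by
  refine le_antisymm (G.stateVtx_le_iff.2 ⟨?_, fun e' h => ?_⟩) (mergeAlong_le_iff.2
    ⟨G.stateVtx_le_iff.2 ⟨G.vtx_le_stateVtx _, fun e' h => ?_⟩, fun i i' h => ?_⟩)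
  · exact (G.vtx_le_stateVtx _).trans (le_mergeAlong _ _ _)
  · by_cases he : e' = e
    · subst he
      rw [Function.update_self] at h
      exact mergeAlong_rel (j := fun i => G.arrow (e', i, false)) (Or.inr h)
    · rw [Function.update_of_ne he] at h
      refine le_mergeAlong _ _ _ (G.stateVtx_arrow ?_)
      rwa [Function.update_of_ne he]
  · by_cases he : e' = e
    · subst he
      rw [Function.update_self] at h
      exact h.elim
    · rw [Function.update_of_ne he] at h
      refine G.stateVtx_arrow ?_
      rwa [Function.update_of_ne he]
  · refine (Setoid.rel_bool_iff _ (fun i => G.arrow (e, i, false)) i i').2 (h.imp_right fun h => ?_)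
    refine G.stateVtx_arrow ?_
    rwa [Function.update_self]

open Classical in
-- A cut curve never crosses `e`, so the merges made at the other edges already keep it within one
-- vertex class. Hence a path joining the two arrows of `e` forces their classes to agree.
theorem stateOpen_le_stateVtx (t : G.E → EdgeOp) (e : G.E) :
    G.stateOpen t e ≤ G.stateVtx (Function.update t e .del) := by
  refine curveSetoid_le_iff.2 fun p => ⟨G.vtx_le_stateVtx _ (G.vtx_σ p), ?_⟩
  by_cases h : ∃ x, G.ends e x = p
  · obtain ⟨x, rfl⟩ := h
    rw [relink_pts (G.ends_injective e)]
    exact Setoid.refl' _ _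
  rw [relink_off h]
  by_cases h' : ∃ x, G.arrow x = p
  · obtain ⟨⟨e', x⟩, rfl⟩ := h'
    rw [Packaged.stateτ_arrow G.pack t (e', x)]
    have he : e' ≠ e := fun he => h ⟨x, by rw [he]⟩
    have hle : G.opVtx (t e') e' ≤ G.stateVtx (Function.update t e .del) := by
      rw [Packaged.opVtx_eq G.pack]
      refine sup_le_sup_left (le_iSup_of_le e' ?_) _
      rw [Function.update_of_ne he]
    exact hle (G.opVtx_ends (t e') e' x)
  · rw [Packaged.stateτ_off G.pack t h']
    exact G.vtx_le_stateVtx _ (G.vtx_τ p)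

/-- Seen from outside, the rest of a state of `G` looks like one of four operations on `e`. -/
theorem exists_stateType (t : G.E → EdgeOp) (e : G.E) [DecidableEq G.E] :
    ∃ o : EdgeOp, o ≠ .mcon ∧ (∀ x y, G.stateOpen t e (G.ends e x) (G.ends e y) ↔
      y = x ∨ y = o.smoothing.link x) ∧ (o.mergeVtx ↔ G.stateVtx (Function.update t e .del)
        (G.arrow (e, false, false)) (G.arrow (e, true, false))) := by
  obtain ⟨k, hk⟩ := exists_pairing G.σ_involutive G.σ_ne (G.pack.stateτ_involutive t)
    (G.pack.stateτ_ne t) (G.ends_injective e)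
    (fun x => ⟨(t e).smoothing.link x, G.pack.stateτ_arrow t (e, x)⟩)
  have hle : G.stateOpen t e ≤ G.stateVtx (Function.update t e .del) := by
    convert G.stateOpen_le_stateVtx t e
  have hV : ∀ s, G.stateOpen t e (G.ends e (false, false)) (G.ends e (true, s)) →
      G.stateVtx (Function.update t e .del) (G.arrow (e, false, false))
        (G.arrow (e, true, false)) := fun s h =>
    Setoid.trans' _ (hle h) (G.vtx_le_stateVtx _ (G.vtx_arrow e true s false))
  -- The pairings of contraction and Penrose-contraction contain a path between the two arrows. Only
  -- the pairing of deletion leaves the vertex classes undecided, separating `.del` from `.mdel`.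
  cases k with
  | con => exact ⟨.con, by simp, hk, iff_of_true trivial (hV true ((hk _ _).2 (Or.inr rfl)))⟩
  | pen => exact ⟨.pen, by simp, hk, iff_of_true trivial (hV false ((hk _ _).2 (Or.inr rfl)))⟩
  | del =>
    by_cases h : G.stateVtx (Function.update t e .del) (G.arrow (e, false, false))
        (G.arrow (e, true, false))
    · exact ⟨.mdel, by simp, hk, iff_of_true trivial h⟩
    · exact ⟨.del, by simp, hk, iff_of_false id h⟩

open Classical in
/-- The operation that joins the ends of `e`, and merges their vertex classes, as the rest of the
state `t` does. -/
def stateType (t : G.E → EdgeOp) (e : G.E) : EdgeOp := (G.exists_stateType t e).choose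

theorem stateType_ne (t : G.E → EdgeOp) (e : G.E) : G.stateType t e ≠ .mcon := by
  classical
  exact (G.exists_stateType t e).choose_spec.1

theorem stateOpen_ends (t : G.E → EdgeOp) (e : G.E) (x y : Bool × Bool) :
    G.stateOpen t e (G.ends e x) (G.ends e y) ↔
      y = x ∨ y = (G.stateType t e).smoothing.link x := by
  classical
  exact (G.exists_stateType t e).choose_spec.2.1 x y

open Classical in
theorem stateType_mergeVtx (t : G.E → EdgeOp) (e : G.E) : (G.stateType t e).mergeVtx ↔
    G.stateVtx (Function.update t e .del) (G.arrow (e, false, false))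
      (G.arrow (e, true, false)) :=
  (G.exists_stateType t e).choose_spec.2.2

/-- The number of closed curves in the state `t` that do not meet the edge `e`. -/
def freeCirc (t : G.E → EdgeOp) (e : G.E) : ℕ := freeClasses (G.stateOpen t e) (G.ends e)

open Classical in
/-- The number of vertex classes in the state `t` that do not meet the edge `e`. -/
def freeVtx (t : G.E → EdgeOp) (e : G.E) : ℕ :=
  freeClasses (G.stateVtx (Function.update t e .del)) (fun i => G.arrow (e, i, false))

open Classical in
theorem stateCirc_update (t : G.E → EdgeOp) (e : G.E) (o : EdgeOp) :
    G.stateCirc (Function.update t e o) =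
      mergeAlong (G.stateOpen t e) (G.ends e) (fun x y => y = o.smoothing.link x) := by
  rw [stateCirc, Packaged.stateτ_update G.pack t e o, curveSetoid_relink (G.ends_injective e)]
  rfl

open Classical in
-- Curves that avoid `e` are unaffected; those through `e` are the cycles in the union of two
-- pairings, one from the rest of the state and one from `o`.
theorem card_stateCirc_update (t : G.E → EdgeOp) (e : G.E) (o : EdgeOp) :
    Nat.card (Quotient (G.stateCirc (Function.update t e o))) =
      G.freeCirc t e + if (G.stateType t e).smoothing = o.smoothing then 2 else 1 := by
  rw [stateCirc_update, ← mergeAlong_mergeAlong_bot, card_quotient_mergeAlong]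
  simp only [stateOpen_ends, card_quotient_pairings]
  rfl

open Classical in
theorem card_stateVtx_update (t : G.E → EdgeOp) (e : G.E) (o : EdgeOp) :
    Nat.card (Quotient (G.stateVtx (Function.update t e o))) =
      G.freeVtx t e + if o.mergeVtx ∨ (G.stateType t e).mergeVtx then 1 else 2 := by
  rw [stateVtx_update, card_quotient_mergeAlong, mergeAlong_boolSetoid, card_quotient_boolSetoid,
    stateType_mergeVtx]
  congr!

/-! ### States of a 2-sum -/

theorem stateτ_twoSum (H : VertexPartitioned) (f : G.E) (e : H.E) (φ : Bool ≃ Bool)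
    (s : G.E → EdgeOp) (t : H.E → EdgeOp) :
    (G.twoSum f H e φ).pack.stateτ (Sum.elim (fun f' => s f'.1) (fun e' => t e'.1)) =
      relink (Sum.map (G.pack.stateτ s) (H.pack.stateτ t)) (Sum.map (G.ends f) (H.ends e))
        (ArrowPresentation.sumLink φ) := by
  have hinj : Function.Injective (Sum.map (G.ends f) (H.ends e)) :=
    G.sumEnds_injective H.toArrowPresentation f e
  funext p
  by_cases h : ∃ x, Sum.map (G.ends f) (H.ends e) x = p
  · obtain ⟨x, rfl⟩ := h
    rw [relink_pts hinj, Packaged.stateτ_off]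
    · exact relink_pts hinj x
    · rintro ⟨⟨f' | e', y⟩, hy⟩ <;> rcases x with x | x
      · exact G.ends_ne f'.2 x y (Sum.inl_injective hy).symm
      · cases hy
      · cases hy
      · exact H.ends_ne e'.2 x y (Sum.inr_injective hy).symm
  · rw [relink_off h]
    by_cases h' : ∃ y, (G.twoSum f H e φ).arrow y = p
    · obtain ⟨⟨f' | e', y⟩, rfl⟩ := h'
      · rw [Packaged.stateτ_arrow (G.twoSum f H e φ).pack]
        exact congrArg Sum.inl (G.pack.stateτ_arrow s (f'.1, y)).symm
      · rw [Packaged.stateτ_arrow (G.twoSum f H e φ).pack]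
        exact congrArg Sum.inr (H.pack.stateτ_arrow t (e'.1, y)).symm
    · rw [Packaged.stateτ_off _ _ h']
      refine (relink_off h).trans ?_
      rcases p with p | p
      · refine congrArg Sum.inl (G.pack.stateτ_off s ?_).symm
        rintro ⟨⟨f', y⟩, rfl⟩
        by_cases hf : f' = f
        · exact h ⟨.inl y, by rw [hf]; rfl⟩
        · exact h' ⟨(.inl ⟨f', hf⟩, y), rfl⟩
      · refine congrArg Sum.inr (H.pack.stateτ_off t ?_).symm
        rintro ⟨⟨e', y⟩, rfl⟩
        by_cases he : e' = e
        · exact h ⟨.inr y, by rw [he]; rfl⟩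
        · exact h' ⟨(.inr ⟨e', he⟩, y), rfl⟩

open Classical in
-- By `card_quotient_glue`, apart from its free curves `H` enters only through how its cut curves
-- connect the ends of `e`. That is the pairing of its type, and the coupling disappears by
-- `Smoothing.link_comm`.
theorem card_stateCirc_twoSum (H : VertexPartitioned) (f : G.E) (e : H.E) (φ : Bool ≃ Bool)
    (s : G.E → EdgeOp) (t : H.E → EdgeOp) :
    Nat.card (Quotient ((G.twoSum f H e φ).stateCirc
      (Sum.elim (fun f' => s f'.1) (fun e' => t e'.1)))) =
    H.freeCirc t e + Nat.card (Quotient (G.stateCirc (Function.update s f (H.stateType t e)))) := by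
  have h1 : (G.twoSum f H e φ).stateCirc (Sum.elim (fun f' => s f'.1) (fun e' => t e'.1)) =
      glue (G.stateOpen s f) (H.stateOpen t e) (G.ends f) (fun x => H.ends e (φ x.1, x.2)) := by
    rw [stateCirc, stateτ_twoSum]
    exact curveSetoid_relink_sum (G.ends_injective f) (H.ends_injective e) φ
  have h2 : freeClasses (H.stateOpen t e) (fun x : Bool × Bool => H.ends e (φ x.1, x.2)) = H.freeCirc t e := by
    refine congrArg Nat.card (congrArg Subtype (funext fun c => propext ⟨fun h i => ?_, fun h i =>
      h _⟩))
    simpa using h (φ.symm i.1, i.2)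
  rw [h1, card_quotient_glue, h2, stateCirc_update]
  congr 3
  refine le_antisymm (mergeAlong_le_iff.2 ⟨le_mergeAlong _ _ _, fun x y h => ?_⟩)
    (mergeAlong_le_iff.2 ⟨le_mergeAlong _ _ _, fun x y h => mergeAlong_rel ?_⟩)
  · have hinj : ∀ x y : Bool × Bool, (φ y.1, y.2) = (φ x.1, x.2) → y = x := fun x y h => by
      simpa [Prod.ext_iff] using h
    rw [stateOpen_ends, Smoothing.link_comm] at h
    rcases h with h | h
    · rw [hinj _ _ h]
    · exact mergeAlong_rel (hinj _ _ h)
  · subst h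
    rw [stateOpen_ends, Smoothing.link_comm]
    exact Or.inr rfl

open Classical in
theorem card_stateVtx_twoSum (H : VertexPartitioned) (f : G.E) (e : H.E) (φ : Bool ≃ Bool)
    (s : G.E → EdgeOp) (t : H.E → EdgeOp) :
    Nat.card (Quotient ((G.twoSum f H e φ).stateVtx
      (Sum.elim (fun f' => s f'.1) (fun e' => t e'.1)))) =
    H.freeVtx t e + Nat.card (Quotient (G.stateVtx (Function.update s f (H.stateType t e)))) := by
  -- Neither `f` nor `e` is an edge of the 2-sum, so both are given the value that merges nothing.
  set S := G.stateVtx (Function.update s f .del) with hS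
  set R := H.stateVtx (Function.update t e .del) with hR
  have h1 : (G.twoSum f H e φ).stateVtx (Sum.elim (fun f' => s f'.1) (fun e' => t e'.1)) =
      glue S R (fun i => G.arrow (f, i, false)) (fun i => H.arrow (e, φ i, false)) := by
    obtain ⟨gS, gR, gj⟩ := glue_le_iff.1 (le_refl (glue S R (fun i => G.arrow (f, i, false))
      (fun i => H.arrow (e, φ i, false))))
    refine le_antisymm ((G.twoSum f H e φ).stateVtx_le_iff.2 ⟨Setoid.eqvGen_le ?_, ?_⟩)
      (glue_le_iff.2 ⟨?_, ?_, fun i => ?_⟩)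
    · rintro _ _ (⟨p, q, h, rfl, rfl⟩ | ⟨p, q, h, rfl, rfl⟩ | ⟨i, s, rfl, rfl⟩)
      · exact gS (G.vtx_le_stateVtx _ h)
      · exact gR (H.vtx_le_stateVtx _ h)
      · exact Setoid.trans' _ (gS (G.vtx_le_stateVtx _ (G.vtx_arrow f i s false)))
          (Setoid.trans' _ (gj i) (gR (H.vtx_le_stateVtx _ (H.vtx_arrow e (φ i) false s))))
    · rintro (f' | e') h
      · refine gS (G.stateVtx_arrow (e := f'.1) ?_)
        rwa [Function.update_of_ne f'.2]
      · refine gR (H.stateVtx_arrow (e := e'.1) ?_)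
        rwa [Function.update_of_ne e'.2]
    · refine G.stateVtx_le_iff.2 ⟨fun p q h => ?_, fun f' h => ?_⟩
      · exact (G.twoSum f H e φ).vtx_le_stateVtx _
          (Relation.EqvGen.rel _ _ (Or.inl ⟨p, q, h, rfl, rfl⟩))
      · by_cases hf : f' = f
        · subst hf
          rw [Function.update_self] at h
          exact h.elim
        · rw [Function.update_of_ne hf] at h
          exact (G.twoSum f H e φ).stateVtx_arrow (e := .inl ⟨f', hf⟩) h
    · refine H.stateVtx_le_iff.2 ⟨fun p q h => ?_, fun e' h => ?_⟩
      · exact (G.twoSum f H e φ).vtx_le_stateVtx _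
          (Relation.EqvGen.rel _ _ (Or.inr (Or.inl ⟨p, q, h, rfl, rfl⟩)))
      · by_cases he : e' = e
        · subst he
          rw [Function.update_self] at h
          exact h.elim
        · rw [Function.update_of_ne he] at h
          exact (G.twoSum f H e φ).stateVtx_arrow (e := .inr ⟨e', he⟩) h
    · exact (G.twoSum f H e φ).vtx_le_stateVtx _
        (Relation.EqvGen.rel _ _ (Or.inr (Or.inr ⟨i, false, rfl, rfl⟩)))
  have h2 : freeClasses R (fun i => H.arrow (e, φ i, false)) = H.freeVtx t e := by
    refine congrArg Nat.card (congrArg Subtype (funext fun c => propext ⟨fun h i => ?_, fun h i =>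
      h _⟩))
    simpa using h (φ.symm i)
  have h3 : (fun i i' => R (H.arrow (e, φ i, false)) (H.arrow (e, φ i', false))) =
      boolSetoid (H.stateType t e).mergeVtx := by
    funext i i'
    rw [Setoid.rel_bool_iff R (fun i => H.arrow (e, i, false)), ← stateType_mergeVtx,
      φ.injective.eq_iff]
    rfl
  rw [h1, card_quotient_glue, h2, stateVtx_update, h3]

end VertexPartitioned

/-! ### State sums with edge-dependent weights -/

/-- The weights of the operations in `Q̂`. -/
def opWeight {R : Type} [CommRing R] (a b c x : R) : EdgeOp → R
  | .del => a
  | .con => b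
  | .pen => c
  | .mdel => x
  | .mcon => 0

theorem EdgeOp.sum_univ {R : Type} [AddCommMonoid R] (g : EdgeOp → R) :
    ∑ o, g o = g .del + g .con + g .pen + g .mdel + g .mcon := by
  rw [show (Finset.univ : Finset EdgeOp) = {.del, .con, .pen, .mdel, .mcon} from rfl]
  simp [add_assoc]

namespace VertexPartitioned

variable (G : VertexPartitioned) {R : Type} [CommRing R]

/-- The sum over all states, with weights that may depend on the edge. -/
def weightedSum (w : G.E → EdgeOp → R) (α β : R) : R :=
  letI := Fintype.ofFinite G.E
  letI := Classical.decEq G.E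
  ∑ t : G.E → EdgeOp, (∏ e, w e (t e)) *
    (α ^ Nat.card (Quotient (G.stateCirc t)) * β ^ Nat.card (Quotient (G.stateVtx t)))

theorem weightedSum_eq [Fintype G.E] [DecidableEq G.E] (w : G.E → EdgeOp → R) (α β : R) :
    G.weightedSum w α β = ∑ t : G.E → EdgeOp, (∏ e, w e (t e)) *
      (α ^ Nat.card (Quotient (G.stateCirc t)) * β ^ Nat.card (Quotient (G.stateVtx t))) := by
  unfold weightedSum
  congr!

/-- The state sum satisfies the recursion that determines `Q`, and `γ = 1` removes the boundary
factor. -/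
theorem Qhat_eq_weightedSum (a b c x α β : R) :
    G.Qhat a b c x α β = G.weightedSum (fun _ => opWeight a b c x) α β := by
  have key : Packaged.IsQ a b c x 0 α β 1 (fun G => G.stateSum (opWeight a b c x) α β 1) := by
    refine ⟨fun G e => ?_, fun G hG => G.stateSum_edgeless _ α β 1 hG⟩
    simp only [G.stateSum_op _ α β 1 e, EdgeOp.sum_univ, opWeight]
  refine (congrFun ((Packaged.isQ_evalQ a b c x 0 α β 1).unique key) G.pack).trans ?_
  unfold Packaged.stateSum Packaged.stateTerm weightedSum
  simp only [one_pow, mul_one]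
  rfl

theorem Zhat_eq_weightedSum (a b α β : R) :
    G.Zhat a b α β = G.weightedSum (fun _ => opWeight a b 0 0) α β := by
  rw [← Qhat_eq_weightedSum]
  have h : Packaged.IsQ a b 0 0 0 α β 1 (fun G => G.evalZ a b α β 1) := by
    simpa [Packaged.IsQ, Packaged.IsZ] using Packaged.isZ_evalZ a b α β 1
  exact congrFun (h.unique (Packaged.isQ_evalQ a b 0 0 0 α β 1)) G.pack

/-- A state of all edges that extends one of the edges other than `e`. -/
def extendState [DecidableEq G.E] {e : G.E} (t : {e' : G.E // e' ≠ e} → EdgeOp) : G.E → EdgeOp :=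
  (Equiv.funSplitAt e EdgeOp).symm (.del, t)

variable {G} in
theorem extendState_val [DecidableEq G.E] {e : G.E} (t : {e' : G.E // e' ≠ e} → EdgeOp)
    (e' : {e' : G.E // e' ≠ e}) : G.extendState t e'.1 = t e' := by
  simp [extendState, Equiv.funSplitAt, Equiv.piSplitAt, e'.2]

variable {G} in
theorem update_extendState [DecidableEq G.E] {e : G.E} (t : {e' : G.E // e' ≠ e} → EdgeOp)
    (o : EdgeOp) :
    Function.update (G.extendState t) e o = (Equiv.funSplitAt e EdgeOp).symm (o, t) := by
  funext e'
  by_cases he : e' = e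
  · subst he
    simp [Equiv.funSplitAt, Equiv.piSplitAt]
  · rw [Function.update_of_ne he]
    simp [extendState, Equiv.funSplitAt, Equiv.piSplitAt, he]

theorem weightedSum_split [Fintype G.E] [DecidableEq G.E] (w : G.E → EdgeOp → R) (α β : R)
    (f : G.E) : G.weightedSum w α β = ∑ t : {e' : G.E // e' ≠ f} → EdgeOp, ∑ o,
      w f o * (∏ e', w e'.1 (t e')) *
        (α ^ Nat.card (Quotient (G.stateCirc (Function.update (G.extendState t) f o))) *
          β ^ Nat.card (Quotient (G.stateVtx (Function.update (G.extendState t) f o)))) := by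
  rw [weightedSum_eq, ← (Equiv.funSplitAt f EdgeOp).symm.sum_comp, Fintype.sum_prod_type,
    Finset.sum_comm]
  refine Finset.sum_congr rfl fun t _ => Finset.sum_congr rfl fun o _ => ?_
  rw [← update_extendState, Fintype.prod_eq_mul_prod_subtype_ne _ f, Function.update_self]
  congr 2
  refine Finset.prod_congr rfl fun e' _ => ?_
  rw [Function.update_of_ne e'.2, extendState_val]

/-- The weight of the operation `o` that replaces an edge when the 2-sum with `G` along `e` is
taken. -/
def typeWeight (e : G.E) (w : G.E → EdgeOp → R) (α β : R) (o : EdgeOp) : R :=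
  letI := Fintype.ofFinite G.E
  letI := Classical.decEq G.E
  ∑ t : {e' : G.E // e' ≠ e} → EdgeOp, (∏ e', w e'.1 (t e')) *
    if G.stateType (G.extendState t) e = o then
      α ^ G.freeCirc (G.extendState t) e * β ^ G.freeVtx (G.extendState t) e else 0

/-- On circles and vertex classes merge-contraction acts as contraction does, so types are chosen to
avoid it. This matches the weight `0` of `.mcon` in `opWeight`. -/
theorem typeWeight_mcon (e : G.E) (w : G.E → EdgeOp → R) (α β : R) :
    G.typeWeight e w α β .mcon = 0 := by
  simp [typeWeight, stateType_ne]

/-- Each state has exactly one type, so after exchanging the sums only one `o` survives for each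
state. -/
theorem sum_mul_typeWeight [Fintype G.E] [DecidableEq G.E] (e : G.E) (w : G.E → EdgeOp → R)
    (α β : R) (m : EdgeOp → R) :
    ∑ o, m o * G.typeWeight e w α β o = ∑ t : {e' : G.E // e' ≠ e} → EdgeOp,
      (∏ e', w e'.1 (t e')) * (α ^ G.freeCirc (G.extendState t) e *
        β ^ G.freeVtx (G.extendState t) e * m (G.stateType (G.extendState t) e)) := by
  have h : ∀ o, G.typeWeight e w α β o = ∑ t : {e' : G.E // e' ≠ e} → EdgeOp,
      (∏ e', w e'.1 (t e')) * if G.stateType (G.extendState t) e = o then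
        α ^ G.freeCirc (G.extendState t) e * β ^ G.freeVtx (G.extendState t) e else 0 := by
    intro o
    unfold typeWeight
    congr!
  simp only [h, Finset.mul_sum]
  rw [Finset.sum_comm]
  refine Finset.sum_congr rfl fun t _ => ?_
  rw [Finset.sum_eq_single (G.stateType (G.extendState t) e)]
  · rw [if_pos rfl]
    ring
  · intro o _ ho
    rw [if_neg (Ne.symm ho), mul_zero, mul_zero]
  · exact fun h => absurd (Finset.mem_univ _) h

open Classical in
-- A state of the 2-sum is a state of `G` off `f` together with a state of `H` off `e`. Grouping the
-- latter by type turns their sum into a sum over operations at `f`.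
theorem weightedSum_twoSum (H : VertexPartitioned) (f : G.E) (e : H.E) (φ : Bool ≃ Bool)
    (w : G.E → EdgeOp → R) (w' : H.E → EdgeOp → R) (α β : R) :
    (G.twoSum f H e φ).weightedSum (Sum.elim (fun f' => w f'.1) (fun e' => w' e'.1)) α β =
      G.weightedSum (Function.update w f (H.typeWeight e w' α β)) α β := by
  let _ := Fintype.ofFinite G.E
  let _ := Fintype.ofFinite H.E
  rw [G.weightedSum_split _ α β f, @weightedSum_eq (G.twoSum f H e φ) R _
    (inferInstanceAs (Fintype ({f' : G.E // f' ≠ f} ⊕ {e' : H.E // e' ≠ e}))) _,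
    ← (Equiv.sumArrowEquivProdArrow {f' : G.E // f' ≠ f} {e' : H.E // e' ≠ e}
      EdgeOp).symm.sum_comp, Fintype.sum_prod_type]
  refine Finset.sum_congr rfl fun s _ => ?_
  have h : ∀ o, Function.update w f (H.typeWeight e w' α β) f o *
      (∏ e', Function.update w f (H.typeWeight e w' α β) e'.1 (s e')) *
        (α ^ Nat.card (Quotient (G.stateCirc (Function.update (G.extendState s) f o))) *
          β ^ Nat.card (Quotient (G.stateVtx (Function.update (G.extendState s) f o)))) =
      ((∏ e', w e'.1 (s e')) *
        (α ^ Nat.card (Quotient (G.stateCirc (Function.update (G.extendState s) f o))) *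
          β ^ Nat.card (Quotient (G.stateVtx (Function.update (G.extendState s) f o))))) *
      H.typeWeight e w' α β o := by
    intro o
    rw [Function.update_self, Finset.prod_congr rfl fun e' _ => by rw [Function.update_of_ne e'.2]]
    ring
  rw [Finset.sum_congr rfl fun o _ => h o, H.sum_mul_typeWeight]
  refine Finset.sum_congr rfl fun t _ => ?_
  have hst : (Equiv.sumArrowEquivProdArrow {f' : G.E // f' ≠ f} {e' : H.E // e' ≠ e}
      EdgeOp).symm (s, t) =
      Sum.elim (fun f' => G.extendState s f'.1) (fun e' => H.extendState t e'.1) := by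
    funext x
    rcases x with x | x
    · exact (extendState_val s x).symm
    · exact (extendState_val t x).symm
  have h1 := G.card_stateCirc_twoSum H f e φ (G.extendState s) (H.extendState t)
  have h2 := G.card_stateVtx_twoSum H f e φ (G.extendState s) (H.extendState t)
  rw [hst]
  refine (congrArg₂ (· * ·) (Fintype.prod_sum_type _)
    (congrArg₂ (fun m n => α ^ m * β ^ n) h1 h2)).trans ?_
  simp only [Sum.elim_inl, Sum.elim_inr, extendState_val]
  rw [pow_add, pow_add]
  ring

theorem stateCirc_op (o : EdgeOp) (e : G.E) (t : G.E → EdgeOp) (ho : t e = o) :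
    (G.op o e).stateCirc (fun e' => t e'.1) = G.stateCirc t := by
  subst ho
  exact congrArg (curveSetoid G.σ) (G.pack.stateτ_op e t)

theorem stateVtx_op (o : EdgeOp) (e : G.E) (t : G.E → EdgeOp) (ho : t e = o) :
    (G.op o e).stateVtx (fun e' => t e'.1) = G.stateVtx t := by
  subst ho
  have h := Packaged.sup_iSup_op G.vtx (fun e => G.pack.vtxRel (t e) e) e
  rw [← G.pack.opVtx_eq] at h
  exact h

open Classical in
-- Here `o` is the operation performed on `e` and `o'` the type of the rest. The coefficients count
-- the circles and vertex classes through `e`; as `o` varies they form the rows of the linear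
-- system.
theorem weightedSum_op (o : EdgeOp) (e : G.E) (w : G.E → EdgeOp → R) (α β : R) :
    (G.op o e).weightedSum (fun e' => w e'.1) α β =
      ∑ o', (α ^ (if o'.smoothing = o.smoothing then 2 else 1) *
        β ^ (if o.mergeVtx ∨ o'.mergeVtx then 1 else 2)) * G.typeWeight e w α β o' := by
  let _ := Fintype.ofFinite G.E
  rw [sum_mul_typeWeight, @weightedSum_eq (G.op o e) R _
    (inferInstanceAs (Fintype {e' : G.E // e' ≠ e})) _]
  refine Finset.sum_congr (by congr!) fun t _ => ?_
  -- A state of the presentation after `o` is read as the restriction of a full state with value `o`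
  -- at `e`.
  have ht : t = fun e' : {e' : G.E // e' ≠ e} => Function.update (G.extendState t) e o e'.1 := by
    funext e'
    rw [Function.update_of_ne e'.2, extendState_val]
  have h1 := G.card_stateCirc_update (G.extendState t) e o
  have h2 := G.card_stateVtx_update (G.extendState t) e o
  rw [← G.stateCirc_op o e _ (Function.update_self _ _ _), ← ht] at h1
  rw [← G.stateVtx_op o e _ (Function.update_self _ _ _), ← ht] at h2
  rw [h1, h2, pow_add, pow_add]
  ring

/-! ### Iterating the 2-sum over the edges of `G` -/

/-- On the iterated 2-sum the unused edges of `G` keep their weight `u`, and the edges from copies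
of `H` carry `w`. Undoing the 2-sum at `f` puts the type weight back at `f`, hence the condition
`hu` on the edges in `l`. -/
theorem weightedSum_sumList (H : VertexPartitioned) (e : H.E) (φ : G.E → (Bool ≃ Bool))
    (l : List G.E) (hl : l.Nodup) (u : G.E → EdgeOp → R) (w : EdgeOp → R) (α β : R)
    (hu : ∀ f ∈ l, u f = H.typeWeight e (fun _ => w) α β) :
    (G.sumList H e φ l hl).1.weightedSum
      (Function.extend (G.sumList H e φ l hl).2 (fun f => u f.1) (fun _ => w)) α β =
      G.weightedSum u α β := by
  classical
  induction l with
  | nil =>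
    have hinj : Function.Injective (fun f : {f : G.E // f ∉ ([] : List G.E)} => f.1) :=
      Subtype.val_injective
    change G.weightedSum (Function.extend (fun f : {f : G.E // f ∉ ([] : List G.E)} => f.1)
      (fun f => u f.1) (fun _ => w)) α β = _
    congr 1
    funext f
    exact hinj.extend_apply (fun f => u f.1) (fun _ => w) ⟨f, List.not_mem_nil⟩
  | cons f l ih =>
    have hl' := List.nodup_cons.1 hl
    rw [← ih hl'.2 fun f' hf' => hu f' (List.mem_cons_of_mem f hf')]
    set K := G.sumList H e φ l hl'.2 with hK
    set f₀ : K.1.E := K.2 ⟨f, hl'.1⟩ with hf₀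
    set v := Function.extend K.2 (fun f => u f.1) (fun _ => w) with hv
    -- `f₀` already carries the weight that `weightedSum_twoSum` would assign to it, so the update
    -- there is trivial.
    have hvf : v f₀ = H.typeWeight e (fun _ => w) α β := by
      rw [hv, hf₀, K.2.injective.extend_apply]
      exact hu f List.mem_cons_self
    have h := K.1.weightedSum_twoSum H f₀ e (φ f) v (fun _ => w) α β
    rw [← hvf, Function.update_eq_self] at h
    rw [← h]
    change (K.1.twoSum f₀ H e (φ f)).weightedSum _ α β = _
    congr 1
    funext g
    by_cases hg : ∃ f', (G.sumList H e φ (f :: l) hl).2 f' = g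
    · obtain ⟨f', rfl⟩ := hg
      rw [(G.sumList H e φ (f :: l) hl).2.injective.extend_apply]
      exact (K.2.injective.extend_apply (fun f => u f.1) (fun _ => w)
        ⟨f'.1, fun hf => f'.2 (List.mem_cons_of_mem f hf)⟩).symm
    · rw [Function.extend_apply' _ _ _ hg]
      rcases g with g | g
      · refine (Function.extend_apply' (f := K.2) (fun f => u f.1) (fun _ => w) g.1 ?_).symm
        rintro ⟨f', hf'⟩
        have hne : f'.1 ≠ f := by
          intro h
          refine g.2 ?_
          rw [← hf']
          exact congrArg K.2 (Subtype.ext h)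
        refine hg ⟨⟨f'.1, fun hm => (List.mem_cons.1 hm).elim hne f'.2⟩, ?_⟩
        exact congrArg Sum.inl (Subtype.ext hf')
      · rfl

theorem Zhat_tensor (H : VertexPartitioned) (e : H.E) (φ : G.E → (Bool ≃ Bool))
    (l : List G.E) (hl : l.Nodup) (hl' : ∀ f, f ∈ l) (a b α β : R) :
    (G.tensor H e φ l hl hl').Zhat a b α β =
      G.weightedSum (fun _ => H.typeWeight e (fun _ => opWeight a b 0 0) α β) α β := by
  rw [Zhat_eq_weightedSum, ← G.weightedSum_sumList H e φ l hl _ (opWeight a b 0 0) α β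
    fun _ _ => rfl]
  congr 1
  funext g
  -- Since `l` contains every edge of `G`, only edges from copies of `H` remain, all with the
  -- weights of `Ẑ`.
  refine (Function.extend_apply' (fun _ => H.typeWeight e (fun _ => opWeight a b 0 0) α β)
    (fun _ => opWeight a b 0 0) g ?_).symm
  rintro ⟨f, _⟩
  exact f.2 (hl' f.1)

end VertexPartitioned

/-! ### The linear system and the theorem -/

/-- The determinant factors as `α * (β - 1) * (α - 1) ^ 2 * (α + 2)`; the hypotheses say that these
factors and the scalar `α * β` do not vanish. -/
theorem tensor_system_unique {F : Type} [Field F] {α β : F} (hα : α ≠ 0) (hβ : β ≠ 0)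
    (hα1 : α - 1 ≠ 0) (hα2 : α + 2 ≠ 0) (hβ1 : β - 1 ≠ 0) {ψ ϕ : Fin 4 → F}
    (h : (α * β) • Matrix.mulVec
          !![α * β, 1, 1, α;
             1, α, 1, 1;
             1, 1, α, 1;
             α, 1, 1, α] ψ = (α * β) • Matrix.mulVec
          !![α * β, 1, 1, α;
             1, α, 1, 1;
             1, 1, α, 1;
             α, 1, 1, α] ϕ) : ψ = ϕ := by
  refine Matrix.mulVec_injective_of_isUnit ?_ (smul_right_injective _ (mul_ne_zero hα hβ) h)
  rw [Matrix.isUnit_iff_isUnit_det, isUnit_iff_ne_zero]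
  have : Matrix.det !![α * β, 1, 1, α; 1, α, 1, 1; 1, 1, α, 1; α, 1, 1, α] =
      α * (β - 1) * (α - 1) ^ 2 * (α + 2) := by
    simp [Matrix.det_succ_row_zero, Fin.sum_univ_succ, Fin.succAbove]
    ring
  rw [this]
  positivity

theorem mainTheorem8 (G H : VertexPartitioned) (e : H.E) (φ : G.E → (Bool ≃ Bool))
    (l : List G.E) (hl : l.Nodup) (hl' : ∀ f, f ∈ l)
    (a b α β : FractionRing (MvPolynomial (Fin 4) ℤ))
    (ha : a = algebraMap _ _ (MvPolynomial.X (0 : Fin 4) : MvPolynomial (Fin 4) ℤ))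
    (hb : b = algebraMap _ _ (MvPolynomial.X (1 : Fin 4) : MvPolynomial (Fin 4) ℤ))
    (hα : α = algebraMap _ _ (MvPolynomial.X (2 : Fin 4) : MvPolynomial (Fin 4) ℤ))
    (hβ : β = algebraMap _ _ (MvPolynomial.X (3 : Fin 4) : MvPolynomial (Fin 4) ℤ)) :
    ∃ ϕ : Fin 4 → FractionRing (MvPolynomial (Fin 4) ℤ),
      (∀ ψ : Fin 4 → FractionRing (MvPolynomial (Fin 4) ℤ),
        (α * β) • Matrix.mulVec
          !![α * β, 1, 1, α;
             1, α, 1, 1;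
             1, 1, α, 1;
             α, 1, 1, α] ψ =
          ![(H.op .del e).Zhat a b α β, (H.op .con e).Zhat a b α β,
            (H.op .pen e).Zhat a b α β, (H.op .mdel e).Zhat a b α β] ↔ ψ = ϕ) ∧
      (G.tensor H e φ l hl hl').Zhat a b α β = G.Qhat (ϕ 0) (ϕ 1) (ϕ 2) (ϕ 3) α β := by
  -- A polynomial with a nonzero value at some integer point is nonzero in the fraction field; the
  -- points `1` and `2` suffice below.
  have hne : ∀ p : MvPolynomial (Fin 4) ℤ, ∀ v : Fin 4 → ℤ, MvPolynomial.eval v p ≠ 0 →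
      algebraMap _ (FractionRing (MvPolynomial (Fin 4) ℤ)) p ≠ 0 := fun p v hv h => hv <| by
    rw [(map_eq_zero_iff _ (IsFractionRing.injective (MvPolynomial (Fin 4) ℤ) _)).1 h, map_zero]
  have h1 : α ≠ 0 := hα ▸ hne _ (fun _ => 1) (by simp)
  have h2 : β ≠ 0 := hβ ▸ hne _ (fun _ => 1) (by simp)
  have h3 : α - 1 ≠ 0 := by simpa [hα] using hne (.X 2 - 1) (fun _ => 2) (by simp)
  have h4 : α + 2 ≠ 0 := by simpa [hα, map_ofNat] using hne (.X 2 + 2) (fun _ => 1) (by simp)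
  have h5 : β - 1 ≠ 0 := by simpa [hβ] using hne (.X 3 - 1) (fun _ => 2) (by simp)
  let ω := H.typeWeight e (fun _ => opWeight a b 0 0) α β
  have hω : H.typeWeight e (fun _ => opWeight a b 0 0) α β = ω := rfl
  have hω' : ω .mcon = 0 := H.typeWeight_mcon e _ α β
  have hZ := fun o => (H.op o e).Zhat_eq_weightedSum a b α β
  -- The type weights solve the system by `weightedSum_op`, so inverting the matrix is needed only
  -- for uniqueness.
  have hsys : (α * β) • Matrix.mulVec
      !![α * β, 1, 1, α;
         1, α, 1, 1;
         1, 1, α, 1;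
         α, 1, 1, α] ![ω .del, ω .con, ω .pen, ω .mdel] =
      ![(H.op .del e).Zhat a b α β, (H.op .con e).Zhat a b α β,
        (H.op .pen e).Zhat a b α β, (H.op .mdel e).Zhat a b α β] := by
    simp only [hZ, H.weightedSum_op _ e (fun _ => opWeight a b 0 0) α β, EdgeOp.sum_univ, hω, hω',
      mul_zero, add_zero]
    ext i
    fin_cases i <;>
      simp [EdgeOp.smoothing, EdgeOp.mergeVtx] <;>
      ring
  refine ⟨![ω .del, ω .con, ω .pen, ω .mdel], fun ψ => ⟨fun h => ?_, fun h => h ▸ hsys⟩, ?_⟩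
  · exact tensor_system_unique h1 h2 h3 h4 h5 (h.trans hsys.symm)
  · rw [VertexPartitioned.Zhat_tensor, VertexPartitioned.Qhat_eq_weightedSum]
    congr 1
    funext _ o
    cases o <;> first | rfl | exact hω'

end
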